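/- A \emph{set difference estimator} over a universe of size $u$ is a data structure that implicitly maintains two sets $S_1,S_2$ and supports: \emph{update}$(x,i)$, which adds $x$ to $S_i$ ($i\in\{1,2\}$); \emph{merge} with a second estimator representing $S_1',S_2'$, which returns a new estimator representing $S_1\cup S_1'$ and $S_2\cup S_2'$; and \emph{query}, which returns an estimate of $|S_1\oplus S_2|$. A new estimator represents $S_1=S_2=\emptyset$. Elements are added without repetition: an update adds an element that is not yet in $S_i$, and the unions formed by merges are disjoint, so that each element contributes at most once to $S_1$ and at most once to $S_2$. We work on a word RAM with $w$-bit words and unit-cost arithmetic (including multiplication and division), bitwise operations, shifts, comparisons, and memory accesses, where $u,n\le 2^w$. The random bits are public coins: a read-only array of uniformly random words, shared by all estimators. They are not counted as space of the estimator, and $O(\log(1/\delta))$ random words suffice. All operations are defined for memory layouts in which the coins and the estimators involved fit into the $2^w$ addressable words. \textbf{Theorem.} There are three fixed word RAM programs (for update, merge and query) and absolute constants $C,K$ such that the following holds for all $w$, all $u\le 2^w$, all $2\le n\le 2^w$ and all $0<\delta\le 1/2$. Given $w$, $\lceil\log_2 n\rceil$ and $\lceil\log_2(1/\delta)\rceil$,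 the programs implement a set difference estimator over a universe of size $u$ which (i) is a string of at most $C\log_2(1/\delta)\log_2 n$ bits, packed into consecutive words (a new estimator being the all-zero string), no other memory being written; (ii) supports update, merge and query in at most $C\log_2(1/\delta)$ steps each, in the worst case; (iii) for every way of building it by updates and merges as above that is fixed independently of the coins and has $|S_1|,|S_2|\le n$, a query returns, with probability at least $1-\delta$ over the coins, a number $a$ with $|S_1\oplus S_2|\le K a$ and $a\le K\,|S_1\oplus S_2|$. -/

import Mathlib

/-! ## The word RAM -/

/-- Unit-cost binary operations on `w`-bit words. Arithmetic is unsigned; `mul` and `mulhi` are the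
low and the high word of a product; `lt` and `eq` return `1` or `0`. -/
inductive WordOp where
  | add | sub | mul | mulhi | div | mod | and | or | xor | shl | shr | lt | eq

/-- The word computed by an operation. -/
def WordOp.eval {w : ℕ} : WordOp → BitVec w → BitVec w → BitVec w
  | .add, a, b => a + b
  | .sub, a, b => a - b
  | .mul, a, b => a * b
  | .mulhi, a, b => BitVec.ofNat w (a.toNat * b.toNat / 2 ^ w)
  | .div, a, b => a / b
  | .mod, a, b => a % b
  | .and, a, b => a &&& b
  | .or, a, b => a ||| b
  | .xor, a, b => a ^^^ b
  | .shl, a, b => a <<< b.toNat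
  | .shr, a, b => a >>> b.toNat
  | .lt, a, b => if a.toNat < b.toNat then 1 else 0
  | .eq, a, b => if a = b then 1 else 0

/-- Word RAM programs. Registers are named by natural numbers; they cannot be addressed indirectly,
so a program uses only the finitely many registers that occur in it. The text of a program does not
depend on the word size. -/
inductive Cmd where
  /-- `dst := c` (modulo `2 ^ w`) -/
  | const (dst c : ℕ)
  /-- `dst := a op b` -/
  | op (o : WordOp) (dst a b : ℕ)
  /-- `dst := mem[a]` -/
  | load (dst a : ℕ)
  /-- `mem[a] := b` -/
  | store (a b : ℕ)
  | seq (p q : Cmd)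
  /-- run `p` if register `a` is nonzero and `q` otherwise -/
  | ifnz (a : ℕ) (p q : Cmd)
  /-- run `p` as long as register `a` is nonzero -/
  | whilenz (a : ℕ) (p : Cmd)

/-- A machine state: registers, and a memory of `2 ^ w` words. -/
@[ext]
structure RamState (w : ℕ) where
  regs : ℕ → BitVec w
  mem : BitVec w → BitVec w

/-- Assign a register. -/
def RamState.setReg {w : ℕ} (s : RamState w) (r : ℕ) (v : BitVec w) : RamState w :=
  { s with regs := Function.update s.regs r v }

/-- Assign a memory word. -/
def RamState.setMem {w : ℕ} (s : RamState w) (a v : BitVec w) : RamState w :=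
  { s with mem := Function.update s.mem a v }

/-- `Exec p s t s'`: started in state `s`, the program `p` halts in state `s'` after exactly `t` steps.
Every instruction and every test of a branch or of a loop is one step. -/
inductive Exec {w : ℕ} : Cmd → RamState w → ℕ → RamState w → Prop
  | const (dst c : ℕ) (s : RamState w) :
      Exec (.const dst c) s 1 (s.setReg dst (BitVec.ofNat w c))
  | op (o : WordOp) (dst a b : ℕ) (s : RamState w) :
      Exec (.op o dst a b) s 1 (s.setReg dst (o.eval (s.regs a) (s.regs b)))
  | load (dst a : ℕ) (s : RamState w) :
      Exec (.load dst a) s 1 (s.setReg dst (s.mem (s.regs a)))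
  | store (a b : ℕ) (s : RamState w) :
      Exec (.store a b) s 1 (s.setMem (s.regs a) (s.regs b))
  | seq {p q : Cmd} {s s' s'' : RamState w} {t t' : ℕ} :
      Exec p s t s' → Exec q s' t' s'' → Exec (.seq p q) s (t + t') s''
  | ifnz_true {a : ℕ} {p q : Cmd} {s s' : RamState w} {t : ℕ} :
      s.regs a ≠ 0 → Exec p s t s' → Exec (.ifnz a p q) s (t + 1) s'
  | ifnz_false {a : ℕ} {p q : Cmd} {s s' : RamState w} {t : ℕ} :
      s.regs a = 0 → Exec q s t s' → Exec (.ifnz a p q) s (t + 1) s'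
  | while_true {a : ℕ} {p : Cmd} {s s' s'' : RamState w} {t t' : ℕ} :
      s.regs a ≠ 0 → Exec p s t s' → Exec (.whilenz a p) s' t' s'' →
        Exec (.whilenz a p) s (t + t' + 1) s''
  | while_false {a : ℕ} {p : Cmd} {s : RamState w} :
      s.regs a = 0 → Exec (.whilenz a p) s 1 s

/-- Called with arguments `args` in registers `0, 1, …` (all other registers being arbitrary) and with
memory `μ`, the program `p` halts within `T` steps, in a state that satisfies `post`. -/
def Cmd.Computes {w : ℕ} (p : Cmd) (args : List ℕ) (μ : BitVec w → BitVec w) (T : ℝ)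
    (post : RamState w → Prop) : Prop :=
  ∀ ρ : ℕ → BitVec w, (∀ (j : ℕ) (hj : j < args.length), ρ j = BitVec.ofNat w args[j]) →
    ∃ (t : ℕ) (s' : RamState w), Exec p ⟨ρ, μ⟩ t s' ∧ (t : ℝ) ≤ T ∧ post s'

/-! ## Memory layout -/

/-- The words of `v` are stored at the addresses `p, p + 1, …, p + m - 1`, which exist. -/
def Holds {w m : ℕ} (μ : BitVec w → BitVec w) (p : ℕ) (v : Fin m → BitVec w) : Prop :=
  p + m ≤ 2 ^ w ∧ ∀ j : Fin m, μ (BitVec.ofNat w (p + j)) = v j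

/-- The blocks of `m` words at `p` and of `l` words at `q` do not overlap. -/
def Apart (p m q l : ℕ) : Prop := p + m ≤ q ∨ q + l ≤ p

/-- `μ'` differs from `μ` at most on the block of `m` words at `p`. -/
def AgreeOutside {w : ℕ} (μ μ' : BitVec w → BitVec w) (p m : ℕ) : Prop :=
  ∀ a : BitVec w, (a.toNat < p ∨ p + m ≤ a.toNat) → μ' a = μ a

/-- The number `⌈B / w⌉` of words that a string of `B` bits occupies. -/
def wordCount (w B : ℕ) : ℕ := (B + w - 1) / w

/-- A string of `B` bits packed into `⌈B / w⌉` words, padded with zeros in the last one. -/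
def packed (w : ℕ) {B : ℕ} (σ : BitVec B) : Fin (wordCount w B) → BitVec w :=
  fun j => σ.extractLsb' (j * w) w

/-! ## What a set difference estimator represents -/

/-- The ways to make a set difference estimator over the universe `U`: a new one, one that results
from `update` with an element `x` and an index `i` (`0` for `S₁`, `1` for `S₂`), and one that results
from `merge`. -/
inductive History (U : Type) where
  | empty
  | update (h : History U) (i : Fin 2) (x : U)
  | merge (h h' : History U)

namespace History

variable {U : Type} [DecidableEq U]

/-- The two sets that are implicitly maintained. -/
def set : History U → Fin 2 → Finset U
  | .empty, _ => ∅
  | .update h i x, j => if j = i then insert x (h.set j) else h.set j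
  | .merge h h', j => h.set j ∪ h'.set j

/-- Altogether, no element is added more than once to the same one of the two sets: an update adds
a new element, and the unions formed by a merge are disjoint. -/
def Fresh : History U → Prop
  | .empty => True
  | .update h i x => h.Fresh ∧ x ∉ h.set i
  | .merge h h' => h.Fresh ∧ h'.Fresh ∧ ∀ i, Disjoint (h.set i) (h'.set i)

/-- The size `|S₁ ⊕ S₂|` of the set difference. -/
def diff (h : History U) : ℕ := (symmDiff (h.set 0) (h.set 1)).card

end History

/-! ## Probability and approximation -/

/-- The probability of an event under the uniform distribution on a finite type. -/
noncomputable def uniformProb {Ω : Type} [Finite Ω] (E : Ω → Prop) : ℝ :=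
  (Nat.card {ω : Ω // E ω} : ℝ) / (Nat.card Ω : ℝ)

/-- `a` equals `d` up to the factor `K` (so `a = 0` if `d = 0`). -/
def WithinFactor (K : ℝ) (a d : ℕ) : Prop := (d : ℝ) ≤ K * a ∧ (a : ℝ) ≤ K * d

/-! ## Correctness of the three operations

`sketch ω h` is the bit string that is kept for an estimator with history `h` when the public coins,
an array of `R` random words, are `ω`. Each program is told the word size `w`, the logarithms `ℓ` and
`k` of the size bound and of the inverse failure probability (both rounded up), where the coins are,
and its proper arguments. Apart from the coins, which it may only read, and from its registers, it has
no memory besides the estimators. -/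

section Operations

variable {w u B R : ℕ}

/-- `update` changes the estimator at address `p` in place. -/
def UpdateCorrect (prog : Cmd) (ℓ k : ℕ) (T : ℝ)
    (sketch : (Fin R → BitVec w) → History (Fin u) → BitVec B) : Prop :=
  ∀ (ω : Fin R → BitVec w) (h : History (Fin u)) (i : Fin 2) (x : Fin u)
    (μ : BitVec w → BitVec w) (c p : ℕ),
    Holds μ c ω → Holds μ p (packed w (sketch ω h)) →
    Apart p (wordCount w B) c R →
    prog.Computes [w, ℓ, k, c, p, i, x] μ T fun s' =>
      Holds s'.mem p (packed w (sketch ω (h.update i x))) ∧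
      AgreeOutside μ s'.mem p (wordCount w B)

/-- `merge` reads the estimators at `p` and `q` and makes a new one at `o`. -/
def MergeCorrect (prog : Cmd) (ℓ k : ℕ) (T : ℝ)
    (sketch : (Fin R → BitVec w) → History (Fin u) → BitVec B) : Prop :=
  ∀ (ω : Fin R → BitVec w) (h h' : History (Fin u)) (μ : BitVec w → BitVec w) (c p q o : ℕ),
    Holds μ c ω → Holds μ p (packed w (sketch ω h)) → Holds μ q (packed w (sketch ω h')) →
    o + wordCount w B ≤ 2 ^ w → Apart o (wordCount w B) c R →
    Apart o (wordCount w B) p (wordCount w B) → Apart o (wordCount w B) q (wordCount w B) →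
    prog.Computes [w, ℓ, k, c, p, q, o] μ T fun s' =>
      Holds s'.mem o (packed w (sketch ω (h.merge h'))) ∧
      AgreeOutside μ s'.mem o (wordCount w B)

/-- `query` reads the estimator at `p` and leaves its answer in register `0`. -/
def QueryCorrect (prog : Cmd) (ℓ k : ℕ) (T : ℝ)
    (sketch : (Fin R → BitVec w) → History (Fin u) → BitVec B)
    (answer : (Fin R → BitVec w) → History (Fin u) → BitVec w) : Prop :=
  ∀ (ω : Fin R → BitVec w) (h : History (Fin u)) (μ : BitVec w → BitVec w) (c p : ℕ),
    Holds μ c ω → Holds μ p (packed w (sketch ω h)) →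
    prog.Computes [w, ℓ, k, c, p] μ T fun s' =>
      s'.regs 0 = answer ω h ∧ s'.mem = μ

end Operations

/-! ## Running programs -/

/-! The sketch is linear over the field with two elements. It consists of `256 * k` fields of `L =
⌈log₂ n⌉` bits, where `k = ⌈log₂ (1/δ)⌉`, and an addition of `x` xors a word `cell L φ x` into each
field, `φ` being the coins of that field. Merging is xor, and elements that lie in both sets cancel
(`History.getLsbD_xorSum`). So bit `L - 1 - i` of a field is the parity of the number of sampled
elements of level `i` in the difference.

Let the difference have `d > 0` elements. At level `⌈log₂ d⌉ - 2` (truncated at 0) the expected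
number of sampled elements is between 1/32 and 1/8. Multiply-shift hashing is pairwise independent
up to a factor 2 (`uniformProb_hash_pair_le`), which suffices for the second moment method: the
parity is odd with constant probability (`le_uniformProb_odd_hit`). The disjunction of 256 fields
therefore almost always has this bit set, and a union bound excludes levels from `⌈log₂ d⌉ + 13` on.
Up to probability 1/256, the lowest one of the disjunction is thus in a short window of positions
determined by `d` (`uniformProb_not_goodGroup_le`, `GoodGroup.exists_lowBit`). Of `k` independent
groups, fewer than a quarter fail, up to probability `2 ^ (-k) ≤ δ` (`uniformProb_quarter_le`).

The groups have to be combined in `O(k)` steps without any working memory. In place of a median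
there is a Boyer-Moore majority vote on positions rounded down to multiples of 32. The window may
straddle a multiple of 32, so a second vote uses positions shifted by 16; the lead of the first vote
tells whether it can be trusted (`winner_spec`). No logarithm is ever computed: positions are
represented by powers of two, a level is converted to a bit by a division, and rounding uses the
remainder modulo `2 ^ 32 - 1` (`toNat_bucket`).

On the machine, no field crosses a word boundary, so that a field is processed in constantly many
steps, and each program is verified by a loop invariant. -/

@[simp] theorem RamState.setReg_regs {w : ℕ} (s : RamState w) (r r' : ℕ) (v : BitVec w) :
    (s.setReg r v).regs r' = if r' = r then v else s.regs r' := by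
  simp [RamState.setReg, Function.update_apply]

@[simp] theorem RamState.setReg_mem {w : ℕ} (s : RamState w) (r : ℕ) (v : BitVec w) :
    (s.setReg r v).mem = s.mem := rfl

@[simp] theorem RamState.setMem_regs {w : ℕ} (s : RamState w) (a v : BitVec w) :
    (s.setMem a v).regs = s.regs := rfl

@[simp] theorem RamState.setMem_mem {w : ℕ} (s : RamState w) (a v : BitVec w) :
    (s.setMem a v).mem = Function.update s.mem a v := rfl

/-- Instructions without control flow. -/
inductive Instr where
  | const (dst c : ℕ)
  | op (o : WordOp) (dst a b : ℕ)
  | load (dst a : ℕ)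
  | store (a b : ℕ)

def Instr.toCmd : Instr → Cmd
  | .const d c => .const d c
  | .op o d a b => .op o d a b
  | .load d a => .load d a
  | .store a b => .store a b

/-- The effect of an instruction. -/
def Instr.step {w : ℕ} : RamState w → Instr → RamState w
  | s, .const d c => s.setReg d (BitVec.ofNat w c)
  | s, .op o d a b => s.setReg d (o.eval (s.regs a) (s.regs b))
  | s, .load d a => s.setReg d (s.mem (s.regs a))
  | s, .store a b => s.setMem (s.regs a) (s.regs b)

/-- Straight-line code, followed by a step without effect. -/
def block : List Instr → Cmd
  | [] => .op .or 0 0 0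
  | i :: l => .seq i.toCmd (block l)

theorem Instr.exec {w : ℕ} (i : Instr) (s : RamState w) : Exec i.toCmd s 1 (i.step s) := by
  cases i
  · exact Exec.const _ _ _
  · exact Exec.op _ _ _ _ _
  · exact Exec.load _ _ _
  · exact Exec.store _ _ _

theorem exec_block {w : ℕ} (l : List Instr) (s : RamState w) :
    Exec (block l) s (l.length + 1) (l.foldl Instr.step s) := by
  induction l generalizing s with
  | nil =>
    have h := Exec.op (w := w) .or 0 0 0 s
    have hs : s.setReg 0 (WordOp.or.eval (s.regs 0) (s.regs 0)) = s := by
      ext1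
      · funext r
        by_cases hr : r = 0 <;> simp [WordOp.eval, hr]
      · rfl
    rw [hs] at h
    exact h
  | cons i l ih =>
    rw [List.length_cons, add_right_comm, Nat.add_comm _ 1]
    have := Exec.seq (i.exec s) (ih (i.step s))
    rwa [show 1 + (l.length + 1) = 1 + l.length + 1 by ring] at this

/-- Started in `s`, the program `p` halts within `T` steps in a state that satisfies `post`. -/
def Runs {w : ℕ} (p : Cmd) (s : RamState w) (T : ℕ) (post : RamState w → Prop) : Prop :=
  ∃ t s', Exec p s t s' ∧ t ≤ T ∧ post s'

theorem Runs.block {w : ℕ} {l : List Instr} {s : RamState w} {post : RamState w → Prop}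
    (h : post (l.foldl Instr.step s)) : Runs (block l) s (l.length + 1) post :=
  ⟨_, _, exec_block l s, le_rfl, h⟩

theorem Runs.seq {w : ℕ} {p q : Cmd} {s : RamState w} {T T' : ℕ} {mid post : RamState w → Prop}
    (hp : Runs p s T mid) (hq : ∀ s', mid s' → Runs q s' T' post) :
    Runs (.seq p q) s (T + T') post := by
  obtain ⟨t, s', h, ht, hm⟩ := hp
  obtain ⟨t', s'', h', ht', hm'⟩ := hq s' hm
  exact ⟨_, s'', h.seq h', Nat.add_le_add ht ht', hm'⟩

/-- A loop that is run `N` times. -/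
theorem Runs.loop {w : ℕ} {a : ℕ} {p : Cmd} {T N : ℕ} (I : ℕ → RamState w → Prop)
    (hbody : ∀ j < N, ∀ s, I j s → s.regs a ≠ 0 ∧ Runs p s T (I (j + 1)))
    (hend : ∀ s, I N s → s.regs a = 0) {s : RamState w} (h0 : I 0 s) :
    Runs (.whilenz a p) s (N * (T + 1) + 1) (I N) := by
  suffices H : ∀ m j, j + m = N → ∀ s, I j s → Runs (.whilenz a p) s (m * (T + 1) + 1) (I N) from
    H N 0 (by simp) s h0
  intro m
  induction m with
  | zero =>
    intro j hj s hs
    obtain rfl : j = N := by omega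
    exact ⟨1, s, .while_false (hend s hs), by simp, hs⟩
  | succ m ih =>
    intro j hj s hs
    obtain ⟨hne, t, s', h, ht, hI⟩ := hbody j (by omega) s hs
    obtain ⟨t', s'', h', ht', hI'⟩ := ih (j + 1) (by omega) s' hI
    exact ⟨_, s'', .while_true hne h h', by rw [Nat.succ_mul]; omega, hI'⟩

theorem Runs.computes {w : ℕ} {p : Cmd} {args : List ℕ} {μ : BitVec w → BitVec w} {T : ℕ} {T' : ℝ}
    {post : RamState w → Prop} (hT : (T : ℝ) ≤ T')
    (h : ∀ s : RamState w, s.mem = μ →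
      (∀ (j : ℕ) (hj : j < args.length), s.regs j = BitVec.ofNat w args[j]) → Runs p s T post) :
    p.Computes args μ T' post := by
  intro ρ hρ
  obtain ⟨t, s', h, ht, hp⟩ := h ⟨ρ, μ⟩ rfl hρ
  exact ⟨t, s', h, le_trans (by exact_mod_cast ht) hT, hp⟩

/-! ## Blocks of memory -/

theorem BitVec.ofNat_inj_of_lt {w a b : ℕ} (ha : a < 2 ^ w) (hb : b < 2 ^ w)
    (h : BitVec.ofNat w a = BitVec.ofNat w b) : a = b := by
  have := congrArg BitVec.toNat h
  simpa [Nat.mod_eq_of_lt, ha, hb] using this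

theorem AgreeOutside.apply {w : ℕ} {μ μ' : BitVec w → BitVec w} {p m a : ℕ}
    (h : AgreeOutside μ μ' p m) (ha : a < 2 ^ w) (hap : a < p ∨ p + m ≤ a) :
    μ' (BitVec.ofNat w a) = μ (BitVec.ofNat w a) :=
  h _ (by simpa [Nat.mod_eq_of_lt ha] using hap)

theorem AgreeOutside.refl {w : ℕ} (μ : BitVec w → BitVec w) (p m : ℕ) : AgreeOutside μ μ p m :=
  fun _ _ => rfl

theorem AgreeOutside.holds {w m l : ℕ} {μ μ' : BitVec w → BitVec w} {p q : ℕ}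
    {v : Fin l → BitVec w} (h : AgreeOutside μ μ' p m) (hq : Holds μ q v) (ha : Apart p m q l) :
    Holds μ' q v := by
  refine ⟨hq.1, fun j => ?_⟩
  have h1 := hq.1
  have := j.2
  rw [h.apply (by omega) (by rcases ha with ha | ha <;> omega), hq.2]

theorem AgreeOutside.update {w m : ℕ} {μ μ' : BitVec w → BitVec w} {p j : ℕ} (hj : j < m)
    (hp : p + m ≤ 2 ^ w) (h : AgreeOutside μ μ' p m) (v : BitVec w) :
    AgreeOutside μ (Function.update μ' (BitVec.ofNat w (p + j)) v) p m := by
  intro a ha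
  rw [Function.update_of_ne, h a ha]
  rintro rfl
  rw [BitVec.toNat_ofNat, Nat.mod_eq_of_lt (by omega)] at ha
  omega

theorem Holds.update {w m : ℕ} {μ : BitVec w → BitVec w} {p : ℕ} {v : Fin m → BitVec w}
    (h : Holds μ p v) (j : Fin m) (y : BitVec w) :
    Holds (Function.update μ (BitVec.ofNat w (p + j)) y) p (Function.update v j y) := by
  refine ⟨h.1, fun i => ?_⟩
  by_cases hij : i = j
  · subst hij; simp
  · rw [Function.update_of_ne hij, Function.update_of_ne, h.2]
    intro he
    have h1 := h.1
    have hi := i.2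
    have hj := j.2
    have := BitVec.ofNat_inj_of_lt (by omega) (by omega) he
    exact hij (Fin.ext (by omega))

/-! ## Packing fields of `L` bits into words, none of them across a word boundary -/

/-- The position of the first bit of field `t`. -/
def fieldPos (w L t : ℕ) : ℕ := w * (t / (w / L)) + t % (w / L) * L

/-- The number of bits of `F` fields. -/
def layoutBits (w L F : ℕ) : ℕ := w * (F / (w / L)) + L * (F % (w / L))

section Layout

variable {w L F t : ℕ}

theorem fieldPos_offset (hL : 0 < L) (hw : L ≤ w) (t : ℕ) :
    t % (w / L) * L + L ≤ w := by
  have hf : 0 < w / L := Nat.div_pos hw hL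
  calc t % (w / L) * L + L = (t % (w / L) + 1) * L := by ring
    _ ≤ w / L * L := Nat.mul_le_mul_right _ (Nat.mod_lt _ hf)
    _ ≤ w := Nat.div_mul_le_self _ _

theorem fieldPos_add_div (hL : 0 < L) (hw : L ≤ w) {b : ℕ} (hb : b < L) (t : ℕ) :
    (fieldPos w L t + b) / w = t / (w / L) := by
  have := fieldPos_offset hL hw t
  rw [fieldPos, add_assoc, Nat.mul_add_div (by omega),
    Nat.div_eq_of_lt (show t % (w / L) * L + b < w by omega), add_zero]

theorem fieldPos_add_mod (hL : 0 < L) (hw : L ≤ w) {b : ℕ} (hb : b < L) (t : ℕ) :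
    (fieldPos w L t + b) % w = t % (w / L) * L + b := by
  have := fieldPos_offset hL hw t
  rw [fieldPos, add_assoc, Nat.mul_add_mod, Nat.mod_eq_of_lt (by omega)]

/-- Quotient and remainder of a bit position by `w` give the word and the slot in it, and these two
determine the field. Hence distinct fields share no bit. -/
theorem eq_of_fieldPos_add_eq (hL : 0 < L) (hw : L ≤ w) {s b c : ℕ} (hb : b < L) (hc : c < L)
    (h : fieldPos w L t + b = fieldPos w L s + c) : t = s := by
  have h1 := fieldPos_add_div hL hw hb t
  have h2 := fieldPos_add_mod hL hw hb t
  rw [h, fieldPos_add_div hL hw hc] at h1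
  rw [h, fieldPos_add_mod hL hw hc] at h2
  have h3 : s % (w / L) = t % (w / L) := by
    have h4 := congrArg (· / L) h2
    simpa [Nat.add_div_of_dvd_right, Nat.mul_comm _ L, Nat.mul_add_div hL, Nat.div_eq_of_lt hb,
      Nat.div_eq_of_lt hc] using h4
  rw [← Nat.div_add_mod t (w / L), ← Nat.div_add_mod s (w / L), h1, h3]

theorem fieldPos_add_le (hL : 0 < L) (hw : L ≤ w) (ht : t < F) :
    fieldPos w L t + L ≤ layoutBits w L F := by
  have hf : 0 < w / L := Nat.div_pos hw hL
  have h1 := fieldPos_offset hL hw t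
  rw [fieldPos, layoutBits]
  rcases (Nat.div_le_div_right (c := w / L) ht.le).lt_or_eq with h | h
  · have := Nat.mul_le_mul_left w (Nat.succ_le_of_lt h)
    rw [Nat.mul_succ] at this
    omega
  · have h2 : t % (w / L) < F % (w / L) := by
      have h3 := Nat.div_add_mod t (w / L)
      have h4 := Nat.div_add_mod F (w / L)
      rw [h] at h3
      omega
    have := Nat.mul_le_mul_right L (Nat.succ_le_of_lt h2)
    rw [Nat.succ_mul] at this
    rw [h, Nat.mul_comm L (F % _)]
    omega

theorem div_lt_wordCount (hL : 0 < L) (hw : L ≤ w) (ht : t < F) :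
    t / (w / L) < wordCount w (layoutBits w L F) := by
  have h := fieldPos_add_le hL hw ht
  rw [wordCount, Nat.lt_iff_add_one_le, Nat.le_div_iff_mul_le (by omega), Nat.add_mul,
    Nat.mul_comm _ w]
  rw [fieldPos] at h
  omega

/-- The witness is the first field of word `j`. This is needed for `merge`, which visits words only
by way of fields and must not miss any. -/
theorem exists_div_eq_of_lt_wordCount (hL : 0 < L) (hw : L ≤ w) {j : ℕ}
    (hj : j < wordCount w (layoutBits w L F)) : ∃ t < F, t / (w / L) = j := by
  have hf : 0 < w / L := Nat.div_pos hw hL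
  refine ⟨w / L * j, ?_, Nat.mul_div_cancel_left _ hf⟩
  rw [wordCount, Nat.lt_iff_add_one_le, Nat.le_div_iff_mul_le (by omega), Nat.add_mul,
    Nat.mul_comm _ w, layoutBits] at hj
  have h4 := Nat.div_add_mod F (w / L)
  have h5 := Nat.mod_lt F hf
  rcases lt_trichotomy j (F / (w / L)) with h | h | h
  · have := Nat.mul_le_mul_left (w / L) (Nat.succ_le_of_lt h)
    rw [Nat.mul_succ] at this
    omega
  · rw [h] at hj ⊢
    have : F % (w / L) ≠ 0 := by
      intro h0
      rw [h0] at hj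
      omega
    omega
  · have h6 := Nat.mul_le_mul_left w (Nat.succ_le_of_lt h)
    have h7 : L * (F % (w / L)) ≤ w :=
      (Nat.mul_le_mul_left L h5.le).trans (Nat.mul_div_le w L)
    rw [Nat.mul_succ] at h6
    omega

/-- A full word wastes fewer than `L` bits and holds at least one field, so at least half of it is
used. The fields in the last, incomplete word waste nothing. -/
theorem layoutBits_le (hL : 0 < L) (hw : L ≤ w) : layoutBits w L F ≤ 3 * (L * F) := by
  have hf : 0 < w / L := Nat.div_pos hw hL
  have h1 : w ≤ 2 * (L * (w / L)) := by
    have h2 := Nat.div_add_mod w L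
    have h3 := Nat.mod_lt w hL
    have := Nat.mul_le_mul_left L hf
    omega
  have h2 := Nat.mul_le_mul_right (F / (w / L)) h1
  have h3 : w / L * (F / (w / L)) ≤ F := Nat.mul_div_le _ _
  have h4 := Nat.mul_le_mul_left L h3
  have h5 := Nat.mul_le_mul_left L (Nat.mod_le F (w / L))
  rw [layoutBits]
  have h6 : 2 * (L * (w / L)) * (F / (w / L)) = 2 * (L * (w / L * (F / (w / L)))) := by ring
  omega

/-- All bits of `v` from position `L` on are zero. -/
def FitsIn (L : ℕ) (v : BitVec w) : Prop := ∀ i, L ≤ i → v.getLsbD i = false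

/-- A bit string that is zero except that field `t` contains `v`. -/
def putField (B L t : ℕ) (v : BitVec w) : BitVec B := v.setWidth B <<< fieldPos w L t

/-- The content of field `t`. -/
def getField {B : ℕ} (w L t : ℕ) (σ : BitVec B) : BitVec w :=
  (σ.extractLsb' (fieldPos w L t) L).setWidth w

theorem getField_xor {B : ℕ} (σ τ : BitVec B) :
    getField w L t (σ ^^^ τ) = getField w L t σ ^^^ getField w L t τ := by
  ext i hi
  simp [getField, BitVec.getLsbD_setWidth, BitVec.getLsbD_extractLsb', ← BitVec.getLsbD_eq_getElem]
  cases decide (i < L) <;> cases decide (i < w) <;> simp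

theorem getField_zero {B : ℕ} : getField w L t (0 : BitVec B) = 0 := by
  ext i hi
  simp [getField]

theorem getLsbD_getField {B : ℕ} (hw : L ≤ w) (σ : BitVec B) (i : ℕ) :
    (getField w L t σ).getLsbD i = (decide (i < L) && σ.getLsbD (fieldPos w L t + i)) := by
  simp only [getField, BitVec.getLsbD_setWidth, BitVec.getLsbD_extractLsb']
  by_cases hi : i < L
  · simp [hi, hi.trans_le hw]
  · simp [hi]

theorem getLsbD_putField {v : BitVec w} (hL : 0 < L) (hw : L ≤ w) (ht : t < F)
    (hv : FitsIn L v) (n : ℕ) :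
    (putField (layoutBits w L F) L t v).getLsbD n =
      (decide (fieldPos w L t ≤ n) && v.getLsbD (n - fieldPos w L t)) := by
  have h := fieldPos_add_le hL hw ht
  simp only [putField, BitVec.getLsbD_shiftLeft, BitVec.getLsbD_setWidth]
  by_cases hn : n < fieldPos w L t
  · simp [hn, Nat.not_le.2 hn]
  · by_cases hn' : n < layoutBits w L F
    · have : n - fieldPos w L t < layoutBits w L F := by omega
      simp [hn, hn', this, Nat.not_lt.1 hn]
    · rw [hv _ (by omega)]
      simp

theorem getField_putField {v : BitVec w} {s : ℕ} (hL : 0 < L) (hw : L ≤ w)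
    (hs : s < F) (hv : FitsIn L v) :
    getField w L t (putField (layoutBits w L F) L s v) = if s = t then v else 0 := by
  refine BitVec.eq_of_getLsbD_eq fun i _ => ?_
  rw [getLsbD_getField hw, getLsbD_putField hL hw hs hv]
  by_cases hi : i < L
  · split_ifs with h
    · subst h; simp [hi]
    · simp only [hi, decide_true, Bool.true_and, BitVec.ofNat_eq_ofNat, BitVec.getLsbD_zero]
      by_contra hc
      simp only [Bool.not_eq_false, Bool.and_eq_true, decide_eq_true_eq] at hc
      have hlt : fieldPos w L t + i - fieldPos w L s < L := by
        by_contra hge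
        rw [hv _ (by omega)] at hc
        simp at hc
      exact h (eq_of_fieldPos_add_eq hL hw hlt hi (by omega))
  · split_ifs with h
    · rw [hv i (by omega)]; simp [hi]
    · simp [hi]

theorem packed_xor {B : ℕ} (σ τ : BitVec B) (j : Fin (wordCount w B)) :
    packed w (σ ^^^ τ) j = packed w σ j ^^^ packed w τ j := by
  refine BitVec.eq_of_getLsbD_eq fun i hi => ?_
  simp [packed, hi]

theorem packed_putField {v : BitVec w} (hL : 0 < L) (hw : L ≤ w) (ht : t < F)
    (hv : FitsIn L v) (j : Fin (wordCount w (layoutBits w L F))) :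
    packed w (putField (layoutBits w L F) L t v) j =
      if (j : ℕ) = t / (w / L) then v <<< (t % (w / L) * L) else 0 := by
  refine BitVec.eq_of_getLsbD_eq fun i hi => ?_
  rw [packed, BitVec.getLsbD_extractLsb', getLsbD_putField hL hw ht hv]
  simp only [hi, decide_true, Bool.true_and]
  split_ifs with h
  · rw [BitVec.getLsbD_shiftLeft, h, fieldPos, Nat.mul_comm w]
    simp only [hi, decide_true, Bool.true_and, Nat.add_le_add_iff_left, Nat.add_sub_add_left]
    congr 1
    rw [← decide_not]
    simp
  · simp only [BitVec.ofNat_eq_ofNat, BitVec.getLsbD_zero]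
    by_contra hc
    simp only [Bool.not_eq_false, Bool.and_eq_true, decide_eq_true_eq] at hc
    have hlt : j * w + i - fieldPos w L t < L := by
      by_contra hge
      rw [hv _ (by omega)] at hc
      simp at hc
    have h1 := fieldPos_add_div hL hw hlt t
    rw [Nat.add_sub_cancel' hc.1, Nat.mul_comm, Nat.mul_add_div (by omega),
      Nat.div_eq_of_lt hi] at h1
    exact h h1

/-- This is the form in which a round of `update` changes the memory: a single word, xored with a
shifted value. -/
theorem packed_xor_putField (σ : BitVec (layoutBits w L F)) {v : BitVec w} (hL : 0 < L)
    (hw : L ≤ w) (ht : t < F) (hv : FitsIn L v) :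
    packed w (σ ^^^ putField (layoutBits w L F) L t v) =
      Function.update (packed w σ) ⟨t / (w / L), div_lt_wordCount hL hw ht⟩
        (packed w σ ⟨t / (w / L), div_lt_wordCount hL hw ht⟩ ^^^ v <<< (t % (w / L) * L)) := by
  funext j
  rw [packed_xor, packed_putField hL hw ht hv, Function.update_apply]
  by_cases h : (j : ℕ) = t / (w / L)
  · obtain rfl : j = ⟨t / (w / L), div_lt_wordCount hL hw ht⟩ := Fin.ext h
    simp
  · rw [if_neg h, if_neg (fun he => h (congrArg Fin.val he))]
    simp

/-- The right-hand side is the shift and mask that `orFieldCode` performs. -/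
theorem getField_eq_packed (σ : BitVec (layoutBits w L F)) (hL : 0 < L) (hw : L ≤ w)
    (ht : t < F) :
    getField w L t σ =
      packed w σ ⟨t / (w / L), div_lt_wordCount hL hw ht⟩ >>> (t % (w / L) * L) &&&
        BitVec.allOnes w >>> (w - L) := by
  refine BitVec.eq_of_getLsbD_eq fun i hi => ?_
  have h1 := fieldPos_offset hL hw t
  rw [getLsbD_getField hw, BitVec.getLsbD_and, BitVec.getLsbD_ushiftRight,
    BitVec.getLsbD_ushiftRight, packed, BitVec.getLsbD_extractLsb', BitVec.getLsbD_allOnes]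
  by_cases hiL : i < L
  · have h2 : t % (w / L) * L + i < w := by omega
    have h3 : w - L + i < w := by omega
    simp only [hiL, h2, h3, decide_true, Bool.true_and, Bool.and_true, fieldPos]
    congr 1
    simp only [Nat.mul_comm w]
    ring
  · have h3 : ¬ w - L + i < w := by omega
    simp [hiL, h3]

end Layout

/-! ## The sketch -/

/-- The value that multiply-shift hashing assigns to `x`, with the `2w`-bit multiplier
`a₁ * 2 ^ w + a₀`. -/
def hashWord {w : ℕ} (a₁ a₀ b x : BitVec w) : BitVec w :=
  a₁ * x + BitVec.ofNat w (a₀.toNat * x.toNat / 2 ^ w) + b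

/-- The least significant one of `z`. -/
def lowBit {w : ℕ} (z : BitVec w) : BitVec w := z &&& (0 - z)

/-- The contribution of `x` to a field of `L` bits. One out of 16 elements is sampled; the level of
an element is the number of trailing zeros of its hash value, and level `i` corresponds to bit
`L - 1 - i`. -/
def cell {w : ℕ} (L : ℕ) (φ : Fin 6 → BitVec w) (x : BitVec w) : BitVec w :=
  BitVec.ofNat w 1 <<< (L - 1) / lowBit (hashWord (φ 0) (φ 1) (φ 2) x) *
    if hashWord (φ 3) (φ 4) (φ 5) x &&& BitVec.ofNat w 15 = BitVec.ofNat w 0 then 1 else 0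

/-- The six coins that belong to field `t`. -/
def fieldCoins {w F : ℕ} (ω : Fin (F * 6) → BitVec w) (t : ℕ) : Fin 6 → BitVec w :=
  fun i => if h : t < F then ω (finProdFinEquiv (⟨t, h⟩, i)) else 0

/-- The contribution of `x` to the first `n` fields of the sketch. -/
def elementUpTo {w F : ℕ} (L : ℕ) (ω : Fin (F * 6) → BitVec w) (x : BitVec w) :
    ℕ → BitVec (layoutBits w L F)
  | 0 => 0
  | n + 1 => elementUpTo L ω x n ^^^ putField (layoutBits w L F) L n (cell L (fieldCoins ω n) x)

/-- The sum (in the sense of `xor`) of the contributions of all additions of elements. -/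
def History.xorSum {U : Type} {m : ℕ} (g : U → BitVec m) : History U → BitVec m
  | .empty => 0
  | .update h _ x => h.xorSum g ^^^ g x
  | .merge h h' => h.xorSum g ^^^ h'.xorSum g

/-- The bit string that is kept. -/
def sketchBits {w F u : ℕ} (L : ℕ) (ω : Fin (F * 6) → BitVec w) (h : History (Fin u)) :
    BitVec (layoutBits w L F) :=
  h.xorSum fun x : Fin u => elementUpTo L ω (BitVec.ofNat w (x : ℕ)) F

theorem fitsIn_of_toNat_lt {w L : ℕ} {v : BitVec w} (h : v.toNat < 2 ^ L) : FitsIn L v := by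
  intro i hi
  exact Nat.testBit_lt_two_pow (h.trans_le (Nat.pow_le_pow_right (by norm_num) hi))

theorem toNat_one_shiftLeft {w m : ℕ} (hm : m < w) :
    (BitVec.ofNat w 1 <<< m).toNat = 2 ^ m := by
  have h1 : 1 < 2 ^ w := Nat.one_lt_two_pow (by omega)
  rw [BitVec.toNat_shiftLeft, BitVec.toNat_ofNat, Nat.mod_eq_of_lt h1, Nat.shiftLeft_eq, one_mul,
    Nat.mod_eq_of_lt (Nat.pow_lt_pow_right (by norm_num) hm)]

theorem cell_fitsIn {w L : ℕ} (hL : 0 < L) (hw : L ≤ w) (φ : Fin 6 → BitVec w) (x : BitVec w) :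
    FitsIn L (cell L φ x) := by
  apply fitsIn_of_toNat_lt
  have h : 2 ^ (L - 1) < 2 ^ L := Nat.pow_lt_pow_right (by norm_num) (by omega)
  rw [cell]
  split_ifs
  · rw [show (1 : BitVec w) = 1#w from rfl, BitVec.mul_one, BitVec.toNat_udiv,
      toNat_one_shiftLeft (by omega)]
    exact (Nat.div_le_self _ _).trans_lt h
  · simp

/-! ## Update -/

/-- Read three coins, hash the word in register `6`. -/
def hashCode (d : ℕ) : List Instr :=
  [.load d 3, .op .add 3 3 7, .load 21 3, .op .add 3 3 7, .load 22 3, .op .add 3 3 7,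
    .op .mul d d 6, .op .mulhi 21 21 6, .op .add d d 21, .op .add d d 22]

/-- Dividing `2 ^ (L - 1)` by the lowest one moves level `i` to bit `L - 1 - i` without computing
`i`. Levels from `L` on give the quotient 0, and so does a zero hash value, since division by zero
yields 0. The test for sampling is a multiplication by 0 or 1. -/
def cellCode : List Instr :=
  [.op .sub 24 8 20, .op .and 20 20 24, .op .div 20 12 20, .op .and 23 23 13, .op .eq 23 23 8,
    .op .mul 20 20 23]

def xorFieldCode : List Instr :=
  [.op .mod 21 11 9, .op .mul 21 21 1, .op .shl 20 20 21, .op .div 21 11 9, .op .add 21 4 21,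
    .load 22 21, .op .xor 22 22 20, .store 21 22, .op .add 11 11 7, .op .sub 10 10 7]

/-- In all three programs the arguments come first, registers 7 to 19 are for constants and loop
state, and those from 20 on are mostly scratch. This is why the specifications of the code fragments
preserve registers below 20. -/
def updateInit : List Instr :=
  [.const 7 1, .const 8 0, .op .div 9 0 1, .const 10 256, .op .mul 10 10 2, .const 11 0,
    .op .sub 12 1 7, .op .shl 12 7 12, .const 13 15]

def updateProgram : Cmd :=
  .seq (block updateInit) (.whilenz 10 (block (hashCode 20 ++ (hashCode 23 ++
    (cellCode ++ xorFieldCode)))))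

section Update

variable {w : ℕ}

theorem hashCode_spec {s : RamState w} {c d : ℕ} (hd : 20 ≤ d) (hd1 : d ≠ 21) (hd2 : d ≠ 22)
    (h3 : s.regs 3 = BitVec.ofNat w c) (h7 : s.regs 7 = BitVec.ofNat w 1) :
    ((hashCode d).foldl Instr.step s).mem = s.mem ∧
    ((hashCode d).foldl Instr.step s).regs d = hashWord (s.mem (BitVec.ofNat w c))
      (s.mem (BitVec.ofNat w (c + 1))) (s.mem (BitVec.ofNat w (c + 2))) (s.regs 6) ∧
    ((hashCode d).foldl Instr.step s).regs 3 = BitVec.ofNat w (c + 3) ∧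
    ∀ r, r ≠ 3 → r ≠ d → r ≠ 21 → r ≠ 22 →
      ((hashCode d).foldl Instr.step s).regs r = s.regs r := by
  have e : ∀ n, n < 20 → ¬ n = d := by intros; omega
  have e3 : ¬ d = 3 := by omega
  simp only [hashCode, List.foldl_cons, List.foldl_nil, Instr.step, RamState.setReg_regs,
    RamState.setReg_mem, WordOp.eval]
  refine ⟨trivial, ?_, ?_, fun r hr3 hrd hr1 hr2 => ?_⟩
  · simp [e, e3, h3, h7, hd1.symm, hd2.symm, hd1, hd2, hashWord, BitVec.ofNat_add, add_assoc]
    norm_num [← BitVec.ofNat_add]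
  · simp [e, h3, h7, BitVec.ofNat_add, add_assoc]
    norm_num [← BitVec.ofNat_add]
  · simp [hr3, hrd, hr1, hr2]

theorem cellCode_spec {s : RamState w} {h h' : BitVec w} {L : ℕ}
    (h8 : s.regs 8 = BitVec.ofNat w 0)
    (h12 : s.regs 12 = BitVec.ofNat w 1 <<< (L - 1)) (h13 : s.regs 13 = BitVec.ofNat w 15)
    (h20 : s.regs 20 = h) (h23 : s.regs 23 = h') :
    (cellCode.foldl Instr.step s).mem = s.mem ∧
    (cellCode.foldl Instr.step s).regs 20 = BitVec.ofNat w 1 <<< (L - 1) / lowBit h *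
      (if h' &&& BitVec.ofNat w 15 = BitVec.ofNat w 0 then 1 else 0) ∧
    ∀ r, r < 20 → (cellCode.foldl Instr.step s).regs r = s.regs r := by
  simp only [cellCode, List.foldl_cons, List.foldl_nil, Instr.step, RamState.setReg_regs,
    RamState.setReg_mem, WordOp.eval]
  refine ⟨trivial, ?_, fun r hr => ?_⟩
  · simp [h8, h12, h13, h20, h23, lowBit]
  · simp [hr.ne, (show r ≠ 23 by omega), (show r ≠ 24 by omega)]

theorem xorFieldCode_spec {s : RamState w} {v : BitVec w} {L t p : ℕ} (hw : L ≤ w) (hL : 0 < L)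
    (ht : t < 2 ^ w)
    (h1 : s.regs 1 = BitVec.ofNat w L) (h4 : s.regs 4 = BitVec.ofNat w p)
    (h7 : s.regs 7 = BitVec.ofNat w 1) (h9 : s.regs 9 = BitVec.ofNat w (w / L))
    (h11 : s.regs 11 = BitVec.ofNat w t) (h20 : s.regs 20 = v) :
    (xorFieldCode.foldl Instr.step s).mem =
      Function.update s.mem (BitVec.ofNat w (p + t / (w / L)))
        (s.mem (BitVec.ofNat w (p + t / (w / L))) ^^^ v <<< (t % (w / L) * L)) ∧
    (xorFieldCode.foldl Instr.step s).regs 11 = BitVec.ofNat w (t + 1) ∧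
    (xorFieldCode.foldl Instr.step s).regs 10 = s.regs 10 - BitVec.ofNat w 1 ∧
    ∀ r, r < 20 → r ≠ 10 → r ≠ 11 → (xorFieldCode.foldl Instr.step s).regs r = s.regs r := by
  have hww : w < 2 ^ w := Nat.lt_two_pow_self
  have hf : w / L < 2 ^ w := (Nat.div_le_self _ _).trans_lt hww
  have e1 : (BitVec.ofNat w t / BitVec.ofNat w (w / L) : BitVec w) =
      BitVec.ofNat w (t / (w / L)) := by
    apply BitVec.eq_of_toNat_eq
    rw [BitVec.toNat_udiv]
    simp [Nat.mod_eq_of_lt, ht, hf, (Nat.div_le_self t (w / L)).trans_lt ht]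
  have e2 : (BitVec.ofNat w t % BitVec.ofNat w (w / L) * BitVec.ofNat w L : BitVec w).toNat =
      t % (w / L) * L := by
    have := fieldPos_offset hL hw t
    rw [BitVec.toNat_mul, BitVec.toNat_umod]
    simp only [BitVec.toNat_ofNat, Nat.mod_eq_of_lt, ht, hf, hw.trans_lt hww]
    rw [Nat.mod_eq_of_lt (by omega)]
  simp only [xorFieldCode, List.foldl_cons, List.foldl_nil, Instr.step, RamState.setReg_regs,
    RamState.setReg_mem, RamState.setMem_regs, RamState.setMem_mem, WordOp.eval]
  refine ⟨?_, ?_, ?_, fun r hr hr0 hr1 => ?_⟩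
  · simp [h1, h4, h9, h11, h20, e1, e2, BitVec.ofNat_add]
  · simp [h7, h11, BitVec.ofNat_add]
  · simp [h7]
  · simp [hr0, hr1, hr.ne, (show r ≠ 21 by omega), (show r ≠ 22 by omega)]

theorem ofNat_sub_one_of_pos {n : ℕ} (hn : 0 < n) :
    BitVec.ofNat w n - BitVec.ofNat w 1 = BitVec.ofNat w (n - 1) := by
  obtain ⟨m, rfl⟩ := Nat.exists_eq_succ_of_ne_zero hn.ne'
  rw [Nat.succ_eq_add_one, BitVec.ofNat_add, BitVec.add_sub_cancel, Nat.add_sub_cancel]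

theorem ofNat_div_ofNat {a b : ℕ} (ha : a < 2 ^ w) (hb : b < 2 ^ w) :
    (BitVec.ofNat w a / BitVec.ofNat w b : BitVec w) = BitVec.ofNat w (a / b) := by
  apply BitVec.eq_of_toNat_eq
  rw [BitVec.toNat_udiv]
  simp [Nat.mod_eq_of_lt, ha, hb, (Nat.div_le_self a b).trans_lt ha]

/-- The registers between two rounds of the loop of `updateProgram`. -/
structure UpdateRegs (L c p F t : ℕ) (x : BitVec w) (s : RamState w) : Prop where
  r1 : s.regs 1 = BitVec.ofNat w L
  r3 : s.regs 3 = BitVec.ofNat w (c + 6 * t)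
  r4 : s.regs 4 = BitVec.ofNat w p
  r6 : s.regs 6 = x
  r7 : s.regs 7 = BitVec.ofNat w 1
  r8 : s.regs 8 = BitVec.ofNat w 0
  r9 : s.regs 9 = BitVec.ofNat w (w / L)
  r10 : s.regs 10 = BitVec.ofNat w (F - t)
  r11 : s.regs 11 = BitVec.ofNat w t
  r12 : s.regs 12 = BitVec.ofNat w 1 <<< (L - 1)
  r13 : s.regs 13 = BitVec.ofNat w 15

theorem updateInit_spec {s : RamState w} {L k c p : ℕ} {x : BitVec w} (hw : L ≤ w) (hL : 0 < L)
    (h0 : s.regs 0 = BitVec.ofNat w w) (h1 : s.regs 1 = BitVec.ofNat w L)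
    (h2 : s.regs 2 = BitVec.ofNat w k) (h3 : s.regs 3 = BitVec.ofNat w c)
    (h4 : s.regs 4 = BitVec.ofNat w p) (h6 : s.regs 6 = x) :
    UpdateRegs L c p (k * 256) 0 x (updateInit.foldl Instr.step s) ∧
      (updateInit.foldl Instr.step s).mem = s.mem := by
  have hww : w < 2 ^ w := Nat.lt_two_pow_self
  have e1 := ofNat_div_ofNat hww (hw.trans_lt hww)
  have e2 := ofNat_sub_one_of_pos (w := w) hL
  have e3 : (BitVec.ofNat w (L - 1)).toNat = L - 1 := by
    rw [BitVec.toNat_ofNat, Nat.mod_eq_of_lt (by omega)]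
  simp only [updateInit, List.foldl_cons, List.foldl_nil, Instr.step, RamState.setReg_regs,
    RamState.setReg_mem, WordOp.eval]
  refine ⟨?_, trivial⟩
  constructor <;>
    simp [h0, h1, h2, h3, h4, h6, e1, e2, e3, BitVec.ofNat_mul, BitVec.mul_comm]

theorem update_round {F L c p t : ℕ} {x : BitVec w} {s : RamState w}
    {ω : Fin (F * 6) → BitVec w} (hw : L ≤ w) (hL : 0 < L) (hF : F < 2 ^ w) (ht : t < F)
    (hc : Holds s.mem c ω) (hs : UpdateRegs L c p F t x s) {s' : RamState w}
    (hs' : s' = (hashCode 20 ++ (hashCode 23 ++ (cellCode ++ xorFieldCode))).foldl Instr.step s) :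
    UpdateRegs L c p F (t + 1) x s' ∧
      s'.mem = Function.update s.mem (BitVec.ofNat w (p + t / (w / L)))
        (s.mem (BitVec.ofNat w (p + t / (w / L))) ^^^
          cell L (fieldCoins ω t) x <<< (t % (w / L) * L)) := by
  have hcoin : ∀ i : Fin 6, s.mem (BitVec.ofNat w (c + 6 * t + i)) = fieldCoins ω t i := by
    intro i
    rw [fieldCoins, dif_pos ht, ← hc.2]
    simp only [finProdFinEquiv_apply_val]
    congr 2
    ring
  rw [List.foldl_append, List.foldl_append, List.foldl_append] at hs'
  obtain ⟨m1, v1, c1, f1⟩ := hashCode_spec (d := 20) (by norm_num) (by norm_num) (by norm_num)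
    hs.r3 hs.r7
  set s1 := (hashCode 20).foldl Instr.step s with hs1
  obtain ⟨m2, v2, c2, f2⟩ := hashCode_spec (s := s1) (d := 23) (by norm_num) (by norm_num)
    (by norm_num) c1 (by rw [f1 7 (by norm_num) (by norm_num) (by norm_num) (by norm_num), hs.r7])
  set s2 := (hashCode 23).foldl Instr.step s1 with hs2
  have f12 : ∀ r, r < 20 → r ≠ 3 → s2.regs r = s.regs r := fun r hr hr3 => by
    rw [f2 r hr3 (by omega) (by omega) (by omega), f1 r hr3 (by omega) (by omega) (by omega)]
  obtain ⟨m3, v3, f3⟩ := cellCode_spec (s := s2) (L := L)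
    (by rw [f12 _ (by norm_num) (by norm_num), hs.r8])
    (by rw [f12 _ (by norm_num) (by norm_num), hs.r12])
    (by rw [f12 _ (by norm_num) (by norm_num), hs.r13])
    (by rw [f2 20 (by norm_num) (by norm_num) (by norm_num) (by norm_num), v1]) v2
  set s3 := cellCode.foldl Instr.step s2 with hs3
  have f13 : ∀ r, r < 20 → r ≠ 3 → s3.regs r = s.regs r := fun r hr hr3 => by
    rw [f3 r hr, f12 r hr hr3]
  have v3' : s3.regs 20 = cell L (fieldCoins ω t) x := by
    rw [v3, m1, f1 6 (by norm_num) (by norm_num) (by norm_num) (by norm_num), hs.r6, cell,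
      ← hcoin 0, ← hcoin 1, ← hcoin 2, ← hcoin 3, ← hcoin 4, ← hcoin 5]
    rfl
  obtain ⟨m4, a4, b4, f4⟩ := xorFieldCode_spec (s := s3) (t := t) (p := p) hw hL (by omega)
    (by rw [f13 _ (by norm_num) (by norm_num), hs.r1])
    (by rw [f13 _ (by norm_num) (by norm_num), hs.r4])
    (by rw [f13 _ (by norm_num) (by norm_num), hs.r7])
    (by rw [f13 _ (by norm_num) (by norm_num), hs.r9])
    (by rw [f13 _ (by norm_num) (by norm_num), hs.r11]) v3'
  rw [← hs'] at m4 a4 b4 f4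
  have f14 : ∀ r, r < 20 → r ≠ 3 → r ≠ 10 → r ≠ 11 → s'.regs r = s.regs r :=
    fun r hr hr3 hr0 hr1 => by rw [f4 r hr hr0 hr1, f13 r hr hr3]
  refine ⟨?_, by rw [m4, m3, m2, m1]⟩
  refine ⟨?_, ?_, ?_, ?_, ?_, ?_, ?_, ?_, a4, ?_, ?_⟩
  · rw [f14 _ (by norm_num) (by norm_num) (by norm_num) (by norm_num), hs.r1]
  · rw [f4 _ (by norm_num) (by norm_num) (by norm_num), f3 _ (by norm_num), c2]
    congr 1
  · rw [f14 _ (by norm_num) (by norm_num) (by norm_num) (by norm_num), hs.r4]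
  · rw [f14 _ (by norm_num) (by norm_num) (by norm_num) (by norm_num), hs.r6]
  · rw [f14 _ (by norm_num) (by norm_num) (by norm_num) (by norm_num), hs.r7]
  · rw [f14 _ (by norm_num) (by norm_num) (by norm_num) (by norm_num), hs.r8]
  · rw [f14 _ (by norm_num) (by norm_num) (by norm_num) (by norm_num), hs.r9]
  · rw [b4, f13 _ (by norm_num) (by norm_num), hs.r10, ofNat_sub_one_of_pos (by omega)]
    congr 1
  · rw [f14 _ (by norm_num) (by norm_num) (by norm_num) (by norm_num), hs.r12]
  · rw [f14 _ (by norm_num) (by norm_num) (by norm_num) (by norm_num), hs.r13]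

theorem ofNat_ne_zero_of_lt {n : ℕ} (h0 : 0 < n) (hn : n < 2 ^ w) : BitVec.ofNat w n ≠ 0 := by
  intro h
  have := BitVec.ofNat_inj_of_lt (b := 0) hn (by positivity) h
  omega

theorem updateProgram_correct {L k u : ℕ} {T : ℝ} (hw : L ≤ w) (hL : 0 < L)
    (hT : ((46 * (k * 256) + 20 : ℕ) : ℝ) ≤ T) :
    UpdateCorrect (u := u) updateProgram L k T
      (sketchBits (w := w) (F := k * 256) L) := by
  intro ω h i x μ c p hc hp hap
  have hc1 := hc.1
  -- The memory has room for the `6 * 256 * k` coins, so the field counter does not overflow.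
  have hF : k * 256 < 2 ^ w := by
    have := Nat.two_pow_pos w
    omega
  refine Runs.computes hT fun s hmem hargs => ?_
  -- After `t` rounds the first `t` fields are up to date. After the last round the string is by
  -- definition the sketch of the updated history.
  let I : ℕ → RamState w → Prop := fun t s => UpdateRegs L c p (k * 256) t (BitVec.ofNat w x) s ∧
    Holds s.mem p (packed w (sketchBits L ω h ^^^ elementUpTo L ω (BitVec.ofNat w x) t)) ∧
    AgreeOutside μ s.mem p (wordCount w (layoutBits w L (k * 256)))
  have hinit : Runs (block updateInit) s (updateInit.length + 1) (I 0) := by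
    apply Runs.block
    obtain ⟨hr, hm⟩ := updateInit_spec (s := s) (k := k) hw hL (hargs 0 (by simp))
      (hargs 1 (by simp)) (hargs 2 (by simp)) (hargs 3 (by simp)) (hargs 4 (by simp))
      (hargs 6 (by simp))
    refine ⟨hr, ?_, ?_⟩
    · simpa [hm, hmem, elementUpTo] using hp
    · simpa [hm, hmem] using AgreeOutside.refl _ _ _
  have hloop : ∀ s', I 0 s' → Runs (.whilenz 10 (block (hashCode 20 ++ (hashCode 23 ++
      (cellCode ++ xorFieldCode))))) s' (k * 256 * (37 + 1) + 1) (I (k * 256)) := by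
    intro s' hs'
    refine Runs.loop I (fun t ht s hs => ⟨?_, ?_⟩) (fun s hs => ?_) hs'
    · rw [hs.1.r10]
      exact ofNat_ne_zero_of_lt (by omega) (by omega)
    · refine Runs.block ?_
      obtain ⟨hr, hm⟩ := update_round hw hL hF ht (hs.2.2.holds hc hap) hs.1 rfl
      refine ⟨hr, ?_, ?_⟩
      · rw [hm, elementUpTo, ← BitVec.xor_assoc,
          packed_xor_putField _ hL hw ht (cell_fitsIn hL hw _ _)]
        have := hs.2.1.2 ⟨t / (w / L), div_lt_wordCount hL hw ht⟩
        rw [← this]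
        exact hs.2.1.update ⟨t / (w / L), div_lt_wordCount hL hw ht⟩ _
      · rw [hm]
        exact AgreeOutside.update (div_lt_wordCount hL hw ht) hp.1 hs.2.2 _
    · rw [hs.1.r10, Nat.sub_self]
      rfl
  obtain ⟨t, s', he, ht, hI⟩ := hinit.seq hloop
  refine ⟨t, s', he, ht.trans ?_, hI.2.1, hI.2.2⟩
  simp only [updateInit, List.length_cons, List.length_nil]
  omega

end Update

/-! ## Merge -/

def mergeInit : List Instr :=
  [.const 7 1, .op .div 9 0 1, .const 10 256, .op .mul 10 10 2, .const 11 0]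

def mergeCode : List Instr :=
  [.op .div 20 11 9, .op .add 21 4 20, .load 21 21, .op .add 22 5 20, .load 22 22,
    .op .xor 21 21 22, .op .add 20 6 20, .store 20 21, .op .add 11 11 7, .op .sub 10 10 7]

/-- The loop runs over fields, so it writes a word once for each field in it. Repetition is harmless
because the sources never change, and the number of words need not be computed. -/
def mergeProgram : Cmd :=
  .seq (block mergeInit) (.whilenz 10 (block mergeCode))

section Merge

variable {w : ℕ}

/-- The registers between two rounds of the loop of `mergeProgram`. -/
structure MergeRegs (L p q o F t : ℕ) (s : RamState w) : Prop where
  r4 : s.regs 4 = BitVec.ofNat w p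
  r5 : s.regs 5 = BitVec.ofNat w q
  r6 : s.regs 6 = BitVec.ofNat w o
  r7 : s.regs 7 = BitVec.ofNat w 1
  r9 : s.regs 9 = BitVec.ofNat w (w / L)
  r10 : s.regs 10 = BitVec.ofNat w (F - t)
  r11 : s.regs 11 = BitVec.ofNat w t

theorem mergeInit_spec {s : RamState w} {L k p q o : ℕ} (hw : L ≤ w)
    (h0 : s.regs 0 = BitVec.ofNat w w) (h1 : s.regs 1 = BitVec.ofNat w L)
    (h2 : s.regs 2 = BitVec.ofNat w k) (h4 : s.regs 4 = BitVec.ofNat w p)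
    (h5 : s.regs 5 = BitVec.ofNat w q) (h6 : s.regs 6 = BitVec.ofNat w o) :
    MergeRegs L p q o (k * 256) 0 (mergeInit.foldl Instr.step s) ∧
      (mergeInit.foldl Instr.step s).mem = s.mem := by
  have hww : w < 2 ^ w := Nat.lt_two_pow_self
  have e1 := ofNat_div_ofNat hww (hw.trans_lt hww)
  simp only [mergeInit, List.foldl_cons, List.foldl_nil, Instr.step, RamState.setReg_regs,
    RamState.setReg_mem, WordOp.eval]
  refine ⟨?_, trivial⟩
  constructor <;> simp [h0, h1, h2, h4, h5, h6, e1, BitVec.ofNat_mul, BitVec.mul_comm]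

theorem merge_round {L p q o F t : ℕ} {s : RamState w} (hF : F < 2 ^ w)
    (ht : t < F) (hs : MergeRegs L p q o F t s) :
    MergeRegs L p q o F (t + 1) (mergeCode.foldl Instr.step s) ∧
      (mergeCode.foldl Instr.step s).mem =
        Function.update s.mem (BitVec.ofNat w (o + t / (w / L)))
          (s.mem (BitVec.ofNat w (p + t / (w / L))) ^^^
            s.mem (BitVec.ofNat w (q + t / (w / L)))) := by
  have hww : w < 2 ^ w := Nat.lt_two_pow_self
  have e1 := ofNat_div_ofNat (ht.trans hF) ((Nat.div_le_self w L).trans_lt hww)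
  have e2 := ofNat_sub_one_of_pos (w := w) (show 0 < F - t by omega)
  rw [show F - t - 1 = F - (t + 1) by omega] at e2
  simp only [mergeCode, List.foldl_cons, List.foldl_nil, Instr.step, RamState.setReg_regs,
    RamState.setReg_mem, RamState.setMem_regs, RamState.setMem_mem, WordOp.eval]
  refine ⟨?_, ?_⟩
  · constructor <;> simp [hs.r4, hs.r5, hs.r6, hs.r7, hs.r9, hs.r10, hs.r11, e2, BitVec.ofNat_add]
  · simp [hs.r4, hs.r5, hs.r6, hs.r9, hs.r11, e1, BitVec.ofNat_add]

theorem mergeProgram_correct {L k u : ℕ} {T : ℝ} (hw : L ≤ w) (hL : 0 < L)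
    (hT : ((46 * (k * 256) + 20 : ℕ) : ℝ) ≤ T) :
    MergeCorrect (u := u) mergeProgram L k T
      (sketchBits (w := w) (F := k * 256) L) := by
  intro ω h h' μ c p q o hc hp hq ho _ hop hoq
  have hc1 := hc.1
  have hF : k * 256 < 2 ^ w := by
    have := Nat.two_pow_pos w
    omega
  refine Runs.computes hT fun s hmem hargs => ?_
  let m := wordCount w (layoutBits w L (k * 256))
  let v : Fin m → BitVec w := packed w (sketchBits L ω (h.merge h'))
  let I : ℕ → RamState w → Prop := fun t s => MergeRegs L p q o (k * 256) t s ∧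
    (∀ t' < t, ∀ hm : t' / (w / L) < m,
      s.mem (BitVec.ofNat w (o + t' / (w / L))) = v ⟨t' / (w / L), hm⟩) ∧
    AgreeOutside μ s.mem o m
  have hinit : Runs (block mergeInit) s (mergeInit.length + 1) (I 0) := by
    apply Runs.block
    obtain ⟨hr, hm⟩ := mergeInit_spec (s := s) (k := k) hw (hargs 0 (by simp))
      (hargs 1 (by simp)) (hargs 2 (by simp)) (hargs 4 (by simp)) (hargs 5 (by simp))
      (hargs 6 (by simp))
    refine ⟨hr, by simp, ?_⟩
    simpa [hm, hmem] using AgreeOutside.refl _ _ _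
  have hloop : ∀ s', I 0 s' → Runs (.whilenz 10 (block mergeCode)) s'
      (k * 256 * (11 + 1) + 1) (I (k * 256)) := by
    intro s' hs'
    refine Runs.loop I (fun t ht s hs => ⟨?_, ?_⟩) (fun s hs => ?_) hs'
    · rw [hs.1.r10]
      exact ofNat_ne_zero_of_lt (by omega) (by omega)
    · refine Runs.block ?_
      obtain ⟨hr, hm⟩ := merge_round hF ht hs.1
      have hj : t / (w / L) < m := div_lt_wordCount hL hw ht
      have hv : s.mem (BitVec.ofNat w (p + t / (w / L))) ^^^
          s.mem (BitVec.ofNat w (q + t / (w / L))) = v ⟨t / (w / L), hj⟩ := by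
        have h1 := (hs.2.2.holds hp hop).2 ⟨t / (w / L), hj⟩
        have h2 := (hs.2.2.holds hq hoq).2 ⟨t / (w / L), hj⟩
        simp only at h1 h2
        rw [h1, h2, ← packed_xor]
        rfl
      refine ⟨hr, fun t' ht' hm' => ?_, ?_⟩
      · rw [hm, hv, Function.update_apply]
        split_ifs with he
        -- The word has been written in this or an earlier round; either way it receives the same
        -- value.
        · congr 2
          have : o + t' / (w / L) = o + t / (w / L) :=
            BitVec.ofNat_inj_of_lt (by omega) (by omega) he
          omega
        · refine hs.2.1 t' ?_ hm'
          by_contra hlt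
          obtain rfl : t' = t := by omega
          exact he rfl
      · rw [hm]
        exact AgreeOutside.update hj ho hs.2.2 _
    · rw [hs.1.r10, Nat.sub_self]
      rfl
  obtain ⟨t, s', he, ht, hI⟩ := hinit.seq hloop
  refine ⟨t, s', he, ht.trans ?_, ⟨ho, fun j => ?_⟩, hI.2.2⟩
  · simp only [mergeInit, List.length_cons, List.length_nil]
    omega
  · obtain ⟨t', ht', hj⟩ := exists_div_eq_of_lt_wordCount hL hw j.2
    have := hI.2.1 t' ht' (by rw [hj]; exact j.2)
    simpa only [hj] using this

end Merge

/-! ## Query -/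

/-- One round of the Boyer-Moore majority vote, with the current candidate and its lead. -/
def vote {α : Type} [DecidableEq α] (a : α × ℕ) (v : α) : α × ℕ :=
  if a.2 = 0 then (v, 1) else if v = a.1 then (a.1, a.2 + 1) else (a.1, a.2 - 1)

/-- The result of the Boyer-Moore majority vote on `v 0, …, v (n - 1)`. -/
def majority {α : Type} [DecidableEq α] [Zero α] (v : ℕ → α) : ℕ → α × ℕ
  | 0 => (0, 0)
  | n + 1 => vote (majority v n) (v n)

theorem majority_snd_le {α : Type} [DecidableEq α] [Zero α] (v : ℕ → α) (n : ℕ) :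
    (majority v n).2 ≤ n := by
  induction n with
  | zero => simp [majority]
  | succ n ih =>
    simp only [majority, vote]
    split_ifs <;> simp only <;> omega

/-- The disjunction of the first `n` of the 256 fields in group `j`. -/
def groupUpTo {w : ℕ} (g : ℕ → BitVec w) (j : ℕ) : ℕ → BitVec w
  | 0 => 0
  | n + 1 => groupUpTo g j n ||| g (256 * j + n)

/-- Round the exponent of a power of two down to a multiple of 32. -/
def bucket {w : ℕ} (z : BitVec w) : BitVec w := z / (z % BitVec.ofNat w 4294967295)

/-- The candidate values that group `j` votes for: its highest level, rounded in two ways. -/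
def ballot {w : ℕ} (g : ℕ → BitVec w) (j : ℕ) : BitVec w :=
  bucket (lowBit (groupUpTo g j 256))

def ballotShifted {w : ℕ} (g : ℕ → BitVec w) (j : ℕ) : BitVec w :=
  bucket (lowBit (groupUpTo g j 256) >>> 16)

/-- The bit that wins the vote. -/
def winner {w : ℕ} (g : ℕ → BitVec w) (k : ℕ) : BitVec w :=
  if k < 2 * (majority (ballot g) k).2 then (majority (ballot g) k).1
  else (majority (ballotShifted g) k).1

/-- A winner at position `r` stands for level `L - 1 - r`, and the quotient is `2 ^ (L - 1 - r)`. If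
all fields vanish, the winner is 0 and division by zero gives the answer 0. -/
def estimate {w B : ℕ} (L k : ℕ) (σ : BitVec B) : BitVec w :=
  BitVec.ofNat w 1 <<< (L - 1) / winner (fun t => getField w L t σ) k

/-- Register 13 becomes the mask of `L` ones, by shifting the all-ones word `0 - 1` to the right by
`w - L`. -/
def queryInit : List Instr :=
  [.const 7 1, .const 8 0, .op .div 9 0 1, .op .add 10 2 8, .const 11 0,
    .op .sub 12 1 7, .op .shl 12 7 12, .op .sub 13 8 7, .op .sub 14 0 1, .op .shr 13 13 14,
    .const 14 16, .const 15 4294967295, .const 16 0, .const 17 0, .const 18 0, .const 19 0]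

def orFieldCode : List Instr :=
  [.op .mod 22 11 9, .op .mul 22 22 1, .op .div 23 11 9, .op .add 23 4 23, .load 23 23,
    .op .shr 23 23 22, .op .and 23 23 13, .op .or 20 20 23, .op .add 11 11 7, .op .sub 21 21 7]

def ballotCode : List Instr :=
  [.op .sub 22 8 20, .op .and 20 20 22, .op .shr 21 20 14, .op .mod 22 20 15, .op .div 20 20 22,
    .op .mod 22 21 15, .op .div 21 21 22]

/-- `vote` without branches: the candidate is increased by `v - c` times the bit "the lead is 0",
and the lead by `2 * b - 1`, where `b` says that the lead is 0 or the vote agrees. -/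
def voteCode (v c n : ℕ) : List Instr :=
  [.op .eq 22 n 8, .op .eq 23 v c, .op .or 23 22 23, .op .sub 24 v c, .op .mul 24 24 22,
    .op .add c c 24, .op .add 23 23 23, .op .add n n 23, .op .sub n n 7]

def answerCode : List Instr :=
  [.op .add 20 17 17, .op .lt 20 2 20, .op .sub 22 16 18, .op .mul 22 22 20, .op .add 21 18 22,
    .op .div 0 12 21]

def groupProgram : Cmd :=
  .seq (block [.const 20 0, .const 21 256]) (.seq (.whilenz 21 (block orFieldCode))
    (block (ballotCode ++ (voteCode 20 16 17 ++ (voteCode 21 18 19 ++ [.op .sub 10 10 7])))))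

def queryProgram : Cmd :=
  .seq (block queryInit) (.seq (.whilenz 10 groupProgram) (block answerCode))

section Query

variable {w : ℕ}

/-- The registers during the whole of the loop of `queryProgram`. -/
structure QueryConsts (L p k : ℕ) (s : RamState w) : Prop where
  r1 : s.regs 1 = BitVec.ofNat w L
  r2 : s.regs 2 = BitVec.ofNat w k
  r4 : s.regs 4 = BitVec.ofNat w p
  r7 : s.regs 7 = BitVec.ofNat w 1
  r8 : s.regs 8 = BitVec.ofNat w 0
  r9 : s.regs 9 = BitVec.ofNat w (w / L)
  r12 : s.regs 12 = BitVec.ofNat w 1 <<< (L - 1)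
  r13 : s.regs 13 = BitVec.allOnes w >>> (w - L)
  r14 : s.regs 14 = BitVec.ofNat w 16
  r15 : s.regs 15 = BitVec.ofNat w 4294967295

/-- The registers that hold the state of the two votes. -/
structure QueryVotes (k j : ℕ) (A A' : BitVec w × ℕ) (s : RamState w) : Prop where
  r10 : s.regs 10 = BitVec.ofNat w (k - j)
  r16 : s.regs 16 = A.1
  r17 : s.regs 17 = BitVec.ofNat w A.2
  r18 : s.regs 18 = A'.1
  r19 : s.regs 19 = BitVec.ofNat w A'.2

theorem QueryConsts.of_eq {L p k : ℕ} {s s' : RamState w} (h : QueryConsts L p k s)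
    (he : ∀ r ∈ [1, 2, 4, 7, 8, 9, 12, 13, 14, 15], s'.regs r = s.regs r) :
    QueryConsts L p k s' := by
  constructor <;> rw [he _ (by simp)]
  exacts [h.r1, h.r2, h.r4, h.r7, h.r8, h.r9, h.r12, h.r13, h.r14, h.r15]

theorem QueryVotes.of_eq {k j : ℕ} {A A' : BitVec w × ℕ} {s s' : RamState w}
    (h : QueryVotes k j A A' s) (he : ∀ r ∈ [10, 16, 17, 18, 19], s'.regs r = s.regs r) :
    QueryVotes k j A A' s' := by
  constructor <;> rw [he _ (by simp)]
  exacts [h.r10, h.r16, h.r17, h.r18, h.r19]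

theorem queryInit_spec {s : RamState w} {L k p : ℕ} (hw : L ≤ w) (hL : 0 < L)
    (h0 : s.regs 0 = BitVec.ofNat w w) (h1 : s.regs 1 = BitVec.ofNat w L)
    (h2 : s.regs 2 = BitVec.ofNat w k) (h4 : s.regs 4 = BitVec.ofNat w p) :
    QueryConsts L p k (queryInit.foldl Instr.step s) ∧
      QueryVotes k 0 (0, 0) (0, 0) (queryInit.foldl Instr.step s) ∧
      (queryInit.foldl Instr.step s).regs 11 = BitVec.ofNat w 0 ∧
      (queryInit.foldl Instr.step s).mem = s.mem := by
  have hww : w < 2 ^ w := Nat.lt_two_pow_self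
  have e1 := ofNat_div_ofNat hww (hw.trans_lt hww)
  have e2 := ofNat_sub_one_of_pos (w := w) hL
  have e3 : (BitVec.ofNat w (L - 1)).toNat = L - 1 := by
    rw [BitVec.toNat_ofNat, Nat.mod_eq_of_lt (by omega)]
  have e4 : (BitVec.ofNat w w - BitVec.ofNat w L : BitVec w).toNat = w - L := by
    have : BitVec.ofNat w w = BitVec.ofNat w (w - L) + BitVec.ofNat w L := by
      rw [← BitVec.ofNat_add, Nat.sub_add_cancel hw]
    rw [this, BitVec.add_sub_cancel, BitVec.toNat_ofNat, Nat.mod_eq_of_lt (by omega)]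
  have e5 : (BitVec.ofNat w 0 - BitVec.ofNat w 1 : BitVec w) = BitVec.allOnes w := by
    simp [BitVec.neg_one_eq_allOnes]
  simp only [queryInit, List.foldl_cons, List.foldl_nil, Instr.step, RamState.setReg_regs,
    RamState.setReg_mem, WordOp.eval]
  refine ⟨?_, ?_, ?_, trivial⟩
  · constructor <;> simp [h0, h1, h2, h4, e1, e2, e3, e4, ← e5]
  · constructor <;> simp [h2]
  · simp

theorem orField_round {L p k F t : ℕ} {s : RamState w} (hw : L ≤ w) (hL : 0 < L)
    (hF : F < 2 ^ w) (ht : t < F) (hs : QueryConsts L p k s) {σ : BitVec (layoutBits w L F)}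
    (hp : Holds s.mem p (packed w σ)) (h11 : s.regs 11 = BitVec.ofNat w t) :
    (orFieldCode.foldl Instr.step s).mem = s.mem ∧
    (orFieldCode.foldl Instr.step s).regs 20 = s.regs 20 ||| getField w L t σ ∧
    (orFieldCode.foldl Instr.step s).regs 11 = BitVec.ofNat w (t + 1) ∧
    (orFieldCode.foldl Instr.step s).regs 21 = s.regs 21 - BitVec.ofNat w 1 ∧
    ∀ r, r < 20 → r ≠ 11 → (orFieldCode.foldl Instr.step s).regs r = s.regs r := by
  have hww : w < 2 ^ w := Nat.lt_two_pow_self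
  have hf : w / L < 2 ^ w := (Nat.div_le_self _ _).trans_lt hww
  have e1 := ofNat_div_ofNat (ht.trans hF) hf
  have e2 : (BitVec.ofNat w t % BitVec.ofNat w (w / L) * BitVec.ofNat w L : BitVec w).toNat =
      t % (w / L) * L := by
    have := fieldPos_offset hL hw t
    rw [BitVec.toNat_mul, BitVec.toNat_umod]
    simp only [BitVec.toNat_ofNat, Nat.mod_eq_of_lt, ht.trans hF, hf, hw.trans_lt hww]
    rw [Nat.mod_eq_of_lt (by omega)]
  have e3 : BitVec.ofNat w p + BitVec.ofNat w (t / (w / L)) =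
      BitVec.ofNat w (p + t / (w / L)) := (BitVec.ofNat_add _ _).symm
  have e4 := hp.2 ⟨t / (w / L), div_lt_wordCount hL hw ht⟩
  simp only at e4
  simp only [orFieldCode, List.foldl_cons, List.foldl_nil, Instr.step, RamState.setReg_regs,
    RamState.setReg_mem, WordOp.eval]
  refine ⟨trivial, ?_, ?_, ?_, fun r hr hr1 => ?_⟩
  · rw [getField_eq_packed σ hL hw ht]
    simp [hs.r1, hs.r4, hs.r9, hs.r13, h11, e1, e2, e3, e4]
  · simp [hs.r7, h11, BitVec.ofNat_add]
  · simp [hs.r7]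
  · simp [hr1, hr.ne, (show r ≠ 21 by omega), (show r ≠ 22 by omega), (show r ≠ 23 by omega)]

theorem ballotCode_spec {L p k : ℕ} {s : RamState w} (h16 : 16 < 2 ^ w)
    (hs : QueryConsts L p k s) :
    (ballotCode.foldl Instr.step s).mem = s.mem ∧
    (ballotCode.foldl Instr.step s).regs 20 = bucket (lowBit (s.regs 20)) ∧
    (ballotCode.foldl Instr.step s).regs 21 = bucket (lowBit (s.regs 20) >>> 16) ∧
    ∀ r, r < 20 → (ballotCode.foldl Instr.step s).regs r = s.regs r := by
  have e : (BitVec.ofNat w 16).toNat = 16 := by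
    rw [BitVec.toNat_ofNat, Nat.mod_eq_of_lt h16]
  simp only [ballotCode, List.foldl_cons, List.foldl_nil, Instr.step, RamState.setReg_regs,
    RamState.setReg_mem, WordOp.eval]
  refine ⟨trivial, ?_, ?_, fun r hr => ?_⟩
  · simp [hs.r8, hs.r15, bucket, lowBit]
  · simp [hs.r8, hs.r14, hs.r15, bucket, lowBit, e]
  · simp [hr.ne, (show r ≠ 21 by omega), (show r ≠ 22 by omega)]

theorem voteCode_spec {v c n : ℕ} {s : RamState w} {A : BitVec w × ℕ} (hv : 20 ≤ v) (hv' : v < 22)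
    (hc : c < 20) (hn : n < 20) (hcn : c ≠ n) (hc0 : c ≠ 7)
    (hn7 : n ≠ 7)
    (h7 : s.regs 7 = BitVec.ofNat w 1) (h8 : s.regs 8 = BitVec.ofNat w 0)
    (h1 : s.regs c = A.1) (h2 : s.regs n = BitVec.ofNat w A.2) (hA : A.2 < 2 ^ w) :
    ((voteCode v c n).foldl Instr.step s).mem = s.mem ∧
    ((voteCode v c n).foldl Instr.step s).regs c = (vote A (s.regs v)).1 ∧
    ((voteCode v c n).foldl Instr.step s).regs n = BitVec.ofNat w (vote A (s.regs v)).2 ∧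
    ∀ r, r < 22 → r ≠ c → r ≠ n → ((voteCode v c n).foldl Instr.step s).regs r = s.regs r := by
  have e0 : ∀ m, 22 ≤ m → ¬ c = m ∧ ¬ n = m ∧ ¬ v = m ∧ ¬ m = c ∧ ¬ m = n ∧ ¬ m = v := by
    intros; omega
  obtain ⟨c22, n22, v22, -, -, -⟩ := e0 22 le_rfl
  obtain ⟨c23, n23, v23, c23', -, -⟩ := e0 23 (by norm_num)
  obtain ⟨c24, n24, -, -, -, -⟩ := e0 24 (by norm_num)
  have hz : (BitVec.ofNat w A.2 = BitVec.ofNat w 0) ↔ A.2 = 0 :=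
    ⟨fun h => BitVec.ofNat_inj_of_lt hA (by positivity) h, fun h => by rw [h]⟩
  have e7 : ¬ 7 = c ∧ ¬ 7 = n := ⟨hc0.symm, hn7.symm⟩
  simp only [voteCode, List.foldl_cons, List.foldl_nil, Instr.step, RamState.setReg_regs,
    RamState.setReg_mem, WordOp.eval]
  refine ⟨trivial, ?_, ?_, fun r hr hrc hrn => ?_⟩
  · simp only [c22, n22, v22, c23, n23, v23, c24, hcn, h8, h1, h2, hz, vote,
      if_true, if_false, Nat.reduceEqDiff]
    by_cases hA0 : A.2 = 0
    · simp [hA0]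
    · simp only [hA0, if_false]
      split_ifs <;> simp
  · simp only [c22, n22, v22, c23, n23, v23, c24, n24, c23', hcn.symm, e7,
      h7, h8, h1, h2, hz, vote, if_true, if_false, Nat.reduceEqDiff]
    have e2 : ∀ a b : BitVec w, a + (b + b) - BitVec.ofNat w 1 = a + b + (b - BitVec.ofNat w 1) :=
      fun a b => by simp only [BitVec.sub_eq_add_neg]; ac_rfl
    by_cases hA0 : A.2 = 0
    · by_cases hva : s.regs v = A.1 <;> simp [hA0, hva]
    · by_cases hva : s.regs v = A.1
      · simp only [hA0, hva, if_true, if_false, e2, BitVec.ofNat_add]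
        simp
      · simp only [hA0, hva, if_false]
        rw [← ofNat_sub_one_of_pos (by omega)]
        simp
  · simp [hrc, hrn, hr.ne, (show r ≠ 23 by omega), (show r ≠ 24 by omega)]


theorem answerCode_spec {L p k : ℕ} {s : RamState w} {A A' : BitVec w × ℕ}
    (hs : QueryConsts L p k s) (hv : QueryVotes k k A A' s) (hk : 2 * k < 2 ^ w) (hA : A.2 ≤ k) :
    (answerCode.foldl Instr.step s).mem = s.mem ∧
    (answerCode.foldl Instr.step s).regs 0 = BitVec.ofNat w 1 <<< (L - 1) /
      (if k < 2 * A.2 then A.1 else A'.1) := by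
  -- The lead is at most `k`, so doubling it does not wrap around.
  have e1 : (BitVec.ofNat w A.2 + BitVec.ofNat w A.2 : BitVec w).toNat = 2 * A.2 := by
    rw [← BitVec.ofNat_add, BitVec.toNat_ofNat, Nat.mod_eq_of_lt (by omega), two_mul]
  have e2 : (BitVec.ofNat w k).toNat = k := by
    rw [BitVec.toNat_ofNat, Nat.mod_eq_of_lt (by omega)]
  simp only [answerCode, List.foldl_cons, List.foldl_nil, Instr.step, RamState.setReg_regs,
    RamState.setReg_mem, WordOp.eval]
  refine ⟨trivial, ?_⟩
  by_cases hlt : k < 2 * A.2 <;>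
    simp [hs.r2, hs.r12, hv.r16, hv.r17, hv.r18, e1, e2, hlt]

theorem groupProgram_runs {L p k F j : ℕ} (hw : L ≤ w) (hL : 0 < L) (hF : F < 2 ^ w)
    (hkF : F = k * 256) (hj : j < k) {σ : BitVec (layoutBits w L F)} {g : ℕ → BitVec w}
    (hg : g = fun t => getField w L t σ) {s : RamState w} (hs : QueryConsts L p k s)
    (hv : QueryVotes k j (majority (ballot g) j) (majority (ballotShifted g) j) s)
    (h11 : s.regs 11 = BitVec.ofNat w (256 * j))
    (hp : Holds s.mem p (packed w σ)) :
    Runs groupProgram s 3103 fun s' => QueryConsts L p k s' ∧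
      QueryVotes k (j + 1) (majority (ballot g) (j + 1)) (majority (ballotShifted g) (j + 1)) s' ∧
      s'.regs 11 = BitVec.ofNat w (256 * (j + 1)) ∧ s'.mem = s.mem := by
  have h256 : 256 < 2 ^ w := by omega
  let I : ℕ → RamState w → Prop := fun n s' => QueryConsts L p k s' ∧
    QueryVotes k j (majority (ballot g) j) (majority (ballotShifted g) j) s' ∧
    s'.regs 11 = BitVec.ofNat w (256 * j + n) ∧ s'.mem = s.mem ∧
    s'.regs 20 = groupUpTo g j n ∧ s'.regs 21 = BitVec.ofNat w (256 - n)
  have hinit : Runs (block [.const 20 0, .const 21 256]) s 3 (I 0) := by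
    apply Runs.block
    refine ⟨hs.of_eq ?_, hv.of_eq ?_, ?_, ?_, ?_, ?_⟩ <;>
      simp [Instr.step, h11, groupUpTo]
  have hloop : ∀ s', I 0 s' → Runs (.whilenz 21 (block orFieldCode)) s'
      (256 * (11 + 1) + 1) (I 256) := by
    intro s' hs'
    refine Runs.loop I (fun n hn s' hs' => ⟨?_, ?_⟩) (fun s' hs' => ?_) hs'
    · rw [hs'.2.2.2.2.2]
      exact ofNat_ne_zero_of_lt (by omega) (by omega)
    · obtain ⟨hc, hv, h11, hm, h20, h21⟩ := hs'
      refine Runs.block ?_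
      obtain ⟨m1, a20, a11, a21, f⟩ := orField_round hw hL hF (by omega) hc
        (by rw [hm]; exact hp) h11
      refine ⟨hc.of_eq fun r hr => ?_, hv.of_eq fun r hr => ?_, a11, by rw [m1, hm], ?_, ?_⟩
      · simp only [List.mem_cons, List.not_mem_nil, or_false] at hr
        exact f r (by omega) (by omega)
      · simp only [List.mem_cons, List.not_mem_nil, or_false] at hr
        exact f r (by omega) (by omega)
      · rw [a20, h20, groupUpTo, hg]
      · rw [a21, h21, ofNat_sub_one_of_pos (by omega)]
        congr 1
    · rw [hs'.2.2.2.2.2]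
      rfl
  have hend : ∀ s', I 256 s' → Runs (block (ballotCode ++ (voteCode 20 16 17 ++
      (voteCode 21 18 19 ++ [.op .sub 10 10 7])))) s' 27 fun s' => QueryConsts L p k s' ∧
      QueryVotes k (j + 1) (majority (ballot g) (j + 1)) (majority (ballotShifted g) (j + 1)) s' ∧
      s'.regs 11 = BitVec.ofNat w (256 * (j + 1)) ∧ s'.mem = s.mem := by
    rintro s0 ⟨hc, hv, h11, hm, h20, -⟩
    refine Runs.block ?_
    rw [List.foldl_append, List.foldl_append, List.foldl_append]
    obtain ⟨m1, a1, b1, f1⟩ := ballotCode_spec (by omega) hc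
    set s1 := ballotCode.foldl Instr.step s0 with hs1
    have hle1 := majority_snd_le (ballot g) j
    have hle2 := majority_snd_le (ballotShifted g) j
    obtain ⟨m2, a2, b2, f2⟩ := voteCode_spec (s := s1) (v := 20) (c := 16) (n := 17)
      (A := majority (ballot g) j) (by norm_num) (by norm_num) (by norm_num) (by norm_num)
      (by norm_num) (by norm_num) (by norm_num)
      (by rw [f1 _ (by norm_num), hc.r7]) (by rw [f1 _ (by norm_num), hc.r8])
      (by rw [f1 _ (by norm_num), hv.r16]) (by rw [f1 _ (by norm_num), hv.r17]) (by omega)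
    set s2 := (voteCode 20 16 17).foldl Instr.step s1 with hs2
    have f12 : ∀ r, r < 20 → r ≠ 16 → r ≠ 17 → s2.regs r = s0.regs r := fun r hr h1 h2 => by
      rw [f2 r (by omega) h1 h2, f1 r hr]
    obtain ⟨m3, a3, b3, f3⟩ := voteCode_spec (s := s2) (v := 21) (c := 18) (n := 19)
      (A := majority (ballotShifted g) j) (by norm_num) (by norm_num) (by norm_num) (by norm_num)
      (by norm_num) (by norm_num) (by norm_num)
      (by rw [f12 _ (by norm_num) (by norm_num) (by norm_num), hc.r7])
      (by rw [f12 _ (by norm_num) (by norm_num) (by norm_num), hc.r8])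
      (by rw [f12 _ (by norm_num) (by norm_num) (by norm_num), hv.r18])
      (by rw [f12 _ (by norm_num) (by norm_num) (by norm_num), hv.r19]) (by omega)
    set s3 := (voteCode 21 18 19).foldl Instr.step s2 with hs3
    have f13 : ∀ r, r < 16 → s3.regs r = s0.regs r := fun r hr => by
      rw [f3 r (by omega) (by omega) (by omega), f12 r (by omega) (by omega) (by omega)]
    have f4 : ∀ r, r ≠ 10 → ([Instr.op .sub 10 10 7].foldl Instr.step s3).regs r = s3.regs r :=
      fun r hr => by simp [Instr.step, hr]
    refine ⟨hc.of_eq fun r hr => ?_, ⟨?_, ?_, ?_, ?_, ?_⟩, ?_, ?_⟩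
    · simp only [List.mem_cons, List.not_mem_nil, or_false] at hr
      rw [f4 r (by omega), f13 r (by omega)]
    · simp only [List.foldl_cons, List.foldl_nil, Instr.step, RamState.setReg_regs, if_true,
        WordOp.eval]
      rw [f13 10 (by norm_num), f13 7 (by norm_num), hv.r10, hc.r7,
        ofNat_sub_one_of_pos (by omega)]
      congr 1
    · rw [f4 _ (by norm_num), f3 _ (by norm_num) (by norm_num) (by norm_num), a2, a1, h20]
      rfl
    · rw [f4 _ (by norm_num), f3 _ (by norm_num) (by norm_num) (by norm_num), b2, a1, h20]
      rfl
    · rw [f4 _ (by norm_num), a3, f2 _ (by norm_num) (by norm_num) (by norm_num), b1, h20]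
      rfl
    · rw [f4 _ (by norm_num), b3, f2 _ (by norm_num) (by norm_num) (by norm_num), b1, h20]
      rfl
    · rw [f4 _ (by norm_num), f13 _ (by norm_num), h11, Nat.mul_succ]
    · simp only [List.foldl_cons, List.foldl_nil, Instr.step, RamState.setReg_mem]
      rw [m3, m2, m1, hm]
  obtain ⟨t, s', he, ht, hI⟩ := hinit.seq fun s' hs' => (hloop s' hs').seq hend
  -- The three phases take at most `3 + (256 * 12 + 1) + 27 = 3103` steps.
  exact ⟨t, s', he, ht.trans (by norm_num), hI⟩

theorem queryProgram_correct {L k u : ℕ} {T : ℝ} (hw : L ≤ w) (hL : 0 < L)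
    (hT : ((3104 * k + 28 : ℕ) : ℝ) ≤ T) :
    QueryCorrect (u := u) queryProgram L k T (sketchBits (w := w) (F := k * 256) L)
      fun ω h => estimate L k (sketchBits L ω h) := by
  intro ω h μ c p hc hp
  have hc1 := hc.1
  have hF : k * 256 < 2 ^ w := by
    have := Nat.two_pow_pos w
    omega
  refine Runs.computes hT fun s hmem hargs => ?_
  set σ := sketchBits L ω h with hσ
  let g : ℕ → BitVec w := fun t => getField w L t σ
  let I : ℕ → RamState w → Prop := fun j s => QueryConsts L p k s ∧
    QueryVotes k j (majority (ballot g) j) (majority (ballotShifted g) j) s ∧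
    s.regs 11 = BitVec.ofNat w (256 * j) ∧ s.mem = μ
  have hinit : Runs (block queryInit) s (queryInit.length + 1) (I 0) := by
    apply Runs.block
    obtain ⟨hr, hv, h11, hm⟩ := queryInit_spec (s := s) (k := k) hw hL (hargs 0 (by simp))
      (hargs 1 (by simp)) (hargs 2 (by simp)) (hargs 4 (by simp))
    exact ⟨hr, hv, h11, hm.trans hmem⟩
  have hloop : ∀ s', I 0 s' → Runs (.whilenz 10 groupProgram) s' (k * (3103 + 1) + 1) (I k) := by
    intro s' hs'
    refine Runs.loop I (fun j hj s hs => ⟨?_, ?_⟩) (fun s hs => ?_) hs'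
    · rw [hs.2.1.r10]
      exact ofNat_ne_zero_of_lt (by omega) (by omega)
    · obtain ⟨hr, hv, h11, hm⟩ := hs
      obtain ⟨t, s', he, ht, hI⟩ := groupProgram_runs hw hL hF rfl hj (g := g) rfl hr hv h11
        (by rw [hm]; exact hp)
      exact ⟨t, s', he, ht, hI.1, hI.2.1, hI.2.2.1, hI.2.2.2.trans hm⟩
    · rw [hs.2.1.r10, Nat.sub_self]
      rfl
  have hend : ∀ s', I k s' → Runs (block answerCode) s' (answerCode.length + 1)
      fun s' => s'.regs 0 = estimate L k σ ∧ s'.mem = μ := by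
    rintro s' ⟨hr, hv, -, hm⟩
    apply Runs.block
    obtain ⟨m1, a1⟩ := answerCode_spec hr hv (by omega) (majority_snd_le _ _)
    exact ⟨a1, m1.trans hm⟩
  obtain ⟨t, s', he, ht, hI⟩ := hinit.seq fun s' hs' => (hloop s' hs').seq hend
  refine ⟨t, s', he, ht.trans ?_, hI⟩
  simp only [queryInit, answerCode, List.length_cons, List.length_nil]
  omega

end Query

/-! ## What the query computes -/

section Linear

variable {w L F : ℕ}

theorem getField_elementUpTo (hL : 0 < L) (hw : L ≤ w) (ω : Fin (F * 6) → BitVec w)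
    (x : BitVec w) {t n : ℕ} (hn : n ≤ F) :
    getField w L t (elementUpTo L ω x n) = if t < n then cell L (fieldCoins ω t) x else 0 := by
  induction n with
  | zero => simpa [elementUpTo] using getField_zero
  | succ n ih =>
    rw [elementUpTo, getField_xor, ih (by omega),
      getField_putField hL hw (F := F) (by omega) (cell_fitsIn hL hw _ _)]
    by_cases h : n = t
    · subst h; simp
    · have : t < n + 1 ↔ t < n := by omega
      simp [h, this]

theorem getField_sketchBits {u : ℕ} (hL : 0 < L) (hw : L ≤ w) (ω : Fin (F * 6) → BitVec w)
    {t : ℕ} (ht : t < F) (h : History (Fin u)) :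
    getField w L t (sketchBits L ω h) =
      h.xorSum fun x : Fin u => cell L (fieldCoins ω t) (BitVec.ofNat w (x : ℕ)) := by
  rw [sketchBits]
  induction h with
  | empty => exact getField_zero
  | update h i x ih =>
    rw [History.xorSum, getField_xor, ih, getField_elementUpTo hL hw _ _ le_rfl, if_pos ht]
    rfl
  | merge h h' ih ih' =>
    rw [History.xorSum, getField_xor, ih, ih']
    rfl

/-- Freshness makes every addition raise the size of one of the two sets by one, so the bit is the
parity of the two filtered sizes added together. A common element is counted twice there, which
leaves the symmetric difference. -/
theorem History.getLsbD_xorSum {U : Type} [DecidableEq U] {m : ℕ} (g : U → BitVec m) (b : ℕ)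
    (h : History U) (hf : h.Fresh) :
    (h.xorSum g).getLsbD b =
      decide (Odd (((symmDiff (h.set 0) (h.set 1)).filter fun x => (g x).getLsbD b).card)) := by
  let P : U → Prop := fun x => (g x).getLsbD b = true
  have key : ((h.xorSum g).getLsbD b = true) ↔
      Odd (((h.set 0).filter P).card + ((h.set 1).filter P).card) := by
    induction h with
    | empty => simp [History.xorSum, History.set]
    | update h i x ih =>
      have hx := hf.2
      have ih := ih hf.1
      have hi : ((((h.update i x).set 0).filter P).card + (((h.update i x).set 1).filter P).card) =
          (((h.set 0).filter P).card + ((h.set 1).filter P).card) + if P x then 1 else 0 := by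
        fin_cases i <;> simp only [History.set] <;> simp at hx ⊢ <;>
          rw [Finset.filter_insert] <;> split_ifs <;>
          first
          | rfl
          | (rw [Finset.card_insert_of_notMem (by simp [hx])]; omega)
      rw [hi, History.xorSum, BitVec.getLsbD_xor]
      by_cases hP : P x
      · have hP' : (g x).getLsbD b = true := hP
        rw [if_pos hP, Nat.odd_add_one, ← ih, hP']
        simp
      · have hP' : (g x).getLsbD b = false := by simpa [P] using hP
        rw [if_neg hP, add_zero, ← ih, hP']
        simp
    | merge h h' ih ih' =>
      obtain ⟨h1, h2, h3⟩ := hf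
      have hc : ∀ i, (((h.merge h').set i).filter P).card =
          ((h.set i).filter P).card + ((h'.set i).filter P).card := fun i => by
        rw [History.set, Finset.filter_union, Finset.card_union_of_disjoint]
        exact Finset.disjoint_filter_filter (h3 i)
      rw [hc, hc, History.xorSum, BitVec.getLsbD_xor, Bool.xor_iff_ne, ne_eq,
        Bool.eq_iff_iff, ih h1, ih' h2,
        show ∀ a b c d : ℕ, a + b + (c + d) = (a + c) + (b + d) by intros; ring,
        Nat.odd_add (m := _ + _) (n := _ + _), ← Nat.not_odd_iff_even]
      tauto
  have hs : ((symmDiff (h.set 0) (h.set 1)).filter P).card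
      + 2 * (((h.set 0) ∩ (h.set 1)).filter P).card =
      ((h.set 0).filter P).card + ((h.set 1).filter P).card := by
    rw [← Finset.card_union_add_card_inter, ← Finset.filter_union, ← Finset.filter_inter_distrib,
      two_mul, ← add_assoc, ← Finset.card_union_of_disjoint, ← Finset.filter_union]
    · congr 3
      ext a
      simp only [Finset.mem_union, Finset.mem_symmDiff, Finset.mem_inter]
      tauto
    · apply Finset.disjoint_filter_filter
      rw [Finset.disjoint_left]
      intro a
      simp only [Finset.mem_symmDiff, Finset.mem_inter]
      tauto
  rw [Bool.eq_iff_iff, key, decide_eq_true_iff, ← hs, Nat.odd_add]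
  simp [P]

end Linear

/-! ### Lowest ones, levels and rounding of exponents -/

section Bits

variable {w : ℕ}

/-- Negation keeps the bits up to and including the lowest one and flips all higher bits. -/
theorem getLsbD_lowBit (z : BitVec w) (n : ℕ) :
    (lowBit z).getLsbD n = true ↔ z.getLsbD n = true ∧ ∀ j < n, z.getLsbD j = false := by
  rw [lowBit, BitVec.getLsbD_and, show (0 : BitVec w) - z = -z by simp, BitVec.getLsbD_neg]
  by_cases hz : z.getLsbD n = true
  · have hn : n < w := BitVec.lt_of_getLsbD hz
    have hz' : z[n] = true := by rwa [BitVec.getLsbD_eq_getElem hn] at hz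
    simp [hz', hn]
  · simp [hz]

theorem toNat_lowBit {z : BitVec w} {m : ℕ} (h : z.getLsbD m = true)
    (h' : ∀ j < m, z.getLsbD j = false) : (lowBit z).toNat = 2 ^ m := by
  apply Nat.eq_of_testBit_eq
  intro n
  rw [Nat.testBit_two_pow, Bool.eq_iff_iff, decide_eq_true_iff]
  change (lowBit z).getLsbD n = true ↔ _
  rw [getLsbD_lowBit]
  constructor
  · rintro ⟨h1, h2⟩
    rcases lt_trichotomy m n with hlt | rfl | hlt
    · rw [h2 m hlt] at h; simp at h
    · rfl
    · rw [h' n hlt] at h1; simp at h1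
  · rintro rfl
    exact ⟨h, h'⟩

theorem exists_lowest_bit {z : BitVec w} (hz : z ≠ 0) :
    ∃ m < w, z.getLsbD m = true ∧ ∀ j < m, z.getLsbD j = false := by
  have h : ∃ m, z.getLsbD m = true := by
    by_contra! hc
    refine hz (BitVec.eq_of_getLsbD_eq fun i _ => ?_)
    simpa using hc i
  refine ⟨Nat.find h, BitVec.lt_of_getLsbD (Nat.find_spec h), Nat.find_spec h, fun j hj => ?_⟩
  simpa using Nat.find_min h hj

/-- The number of trailing zeros of `z` is `i`. -/
def HasLevel (z : BitVec w) (i : ℕ) : Prop := z.toNat % 2 ^ (i + 1) = 2 ^ i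

instance (z : BitVec w) (i : ℕ) : Decidable (HasLevel z i) := by
  unfold HasLevel; infer_instance

theorem hasLevel_iff {z : BitVec w} {i : ℕ} :
    HasLevel z i ↔ z.getLsbD i = true ∧ ∀ j < i, z.getLsbD j = false := by
  constructor
  · intro h
    have hb : ∀ j ≤ i, z.getLsbD j = decide (i = j) := fun j hj => by
      have h1 := congrArg (Nat.testBit · j) h
      simpa [Nat.testBit_mod_two_pow, Nat.testBit_two_pow, Nat.lt_succ_of_le hj,
        BitVec.testBit_toNat] using h1
    exact ⟨by simp [hb i le_rfl], fun j hj => by simp [hb j hj.le, hj.ne']⟩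
  · rintro ⟨h1, h2⟩
    apply Nat.eq_of_testBit_eq
    intro j
    rw [Nat.testBit_mod_two_pow, Nat.testBit_two_pow, BitVec.testBit_toNat]
    rcases lt_trichotomy j i with h | rfl | h
    · simp [h2 j h, h.ne']
    · simp [h1]
    · simp [h.ne, show ¬ j < i + 1 by omega]

/-- The element `x` is sampled and its level is `i`. -/
def Hit (φ : Fin 6 → BitVec w) (x : BitVec w) (i : ℕ) : Prop :=
  HasLevel (hashWord (φ 0) (φ 1) (φ 2) x) i ∧ (hashWord (φ 3) (φ 4) (φ 5) x).toNat % 16 = 0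

instance (φ : Fin 6 → BitVec w) (x : BitVec w) (i : ℕ) : Decidable (Hit φ x i) := by
  unfold Hit; infer_instance

theorem and_fifteen_eq_zero (hw : 4 ≤ w) (z : BitVec w) :
    z &&& BitVec.ofNat w 15 = BitVec.ofNat w 0 ↔ z.toNat % 16 = 0 := by
  have h : 2 ^ 4 ≤ 2 ^ w := Nat.pow_le_pow_right (by norm_num) hw
  rw [← BitVec.toNat_inj, BitVec.toNat_and, BitVec.toNat_ofNat, Nat.mod_eq_of_lt (by omega),
    show (15 : ℕ) = 2 ^ 4 - 1 by norm_num, Nat.and_two_pow_sub_one_eq_mod]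
  simp

theorem getLsbD_cell {L i : ℕ} (hw4 : 4 ≤ w) (hw : L ≤ w) (hi : i < L) (φ : Fin 6 → BitVec w)
    (x : BitVec w) : (cell L φ x).getLsbD (L - 1 - i) = true ↔ Hit φ x i := by
  rw [cell, Hit]
  by_cases hs : (hashWord (φ 3) (φ 4) (φ 5) x).toNat % 16 = 0
  · rw [if_pos ((and_fifteen_eq_zero hw4 _).2 hs), show (1 : BitVec w) = 1#w from rfl,
      BitVec.mul_one]
    simp only [hs, and_true]
    set z := hashWord (φ 0) (φ 1) (φ 2) x
    by_cases hz : z = 0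
    · rw [hasLevel_iff, hz]
      simp [lowBit]
    · obtain ⟨m, -, h1, h2⟩ := exists_lowest_bit hz
      rw [← BitVec.testBit_toNat, BitVec.toNat_udiv, toNat_one_shiftLeft (by omega),
        toNat_lowBit h1 h2]
      have hm : HasLevel z i ↔ m = i := by
        rw [hasLevel_iff]
        constructor
        · rintro ⟨h3, h4⟩
          by_contra hne
          rcases Nat.lt_or_gt_of_ne hne with h | h
          · rw [h4 m h] at h1; simp at h1
          · rw [h2 i h] at h3; simp at h3
        · rintro rfl; exact ⟨h1, h2⟩
      rw [hm]
      by_cases hmL : m ≤ L - 1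
      · rw [Nat.pow_div hmL (by norm_num), Nat.testBit_two_pow, decide_eq_true_iff]
        omega
      · rw [Nat.div_eq_of_lt (Nat.pow_lt_pow_right (by norm_num) (by omega))]
        simp only [Nat.zero_testBit, Bool.false_eq_true, false_iff]
        omega
  · rw [if_neg (fun h => hs ((and_fifteen_eq_zero hw4 _).1 h))]
    simp [hs]

theorem getLsbD_groupUpTo (g : ℕ → BitVec w) (j n b : ℕ) :
    (groupUpTo g j n).getLsbD b = true ↔ ∃ s < n, (g (256 * j + s)).getLsbD b = true := by
  induction n with
  | zero => simp [groupUpTo]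
  | succ n ih =>
    rw [groupUpTo, BitVec.getLsbD_or, Bool.or_eq_true, ih]
    constructor
    · rintro (⟨s, hs, h⟩ | h)
      exacts [⟨s, by omega, h⟩, ⟨n, by omega, h⟩]
    · rintro ⟨s, hs, h⟩
      rcases Nat.lt_succ_iff_lt_or_eq.1 hs with hlt | rfl
      exacts [Or.inl ⟨s, hlt, h⟩, Or.inr h]

/-- Since `2 ^ 32` is 1 modulo `2 ^ 32 - 1`, the remainder of `2 ^ m` is `2 ^ (m % 32)`; dividing by
it leaves the rounded exponent. -/
theorem toNat_bucket (hw : 2 ≤ w) {z : BitVec w} {m : ℕ} (hz : z.toNat = 2 ^ m) :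
    (bucket z).toNat = 2 ^ (32 * (m / 32)) := by
  have hm : m < w := by
    have := z.isLt
    rw [hz] at this
    exact (Nat.pow_lt_pow_iff_right (by norm_num)).1 this
  have h : 2 ^ m % (4294967295 % 2 ^ w) = 2 ^ (m % 32) := by
    -- In short words the constant is truncated to `2 ^ w - 1`. It exceeds `2 ^ m` because `w ≥ 2`,
    -- so the remainder is `2 ^ m` itself and everything is rounded to `2 ^ 0`.
    by_cases h32 : w < 32
    · have h1 : 4294967295 % 2 ^ w = 2 ^ w - 1 := by
        interval_cases w <;> norm_num
      have h2 : 2 ^ m * 2 ≤ 2 ^ w := by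
        rw [← pow_succ]; exact Nat.pow_le_pow_right (by norm_num) hm
      have h3 : 2 ^ 2 ≤ 2 ^ w := Nat.pow_le_pow_right (by norm_num) hw
      rw [h1, Nat.mod_eq_of_lt (by omega), Nat.mod_eq_of_lt (by omega)]
    · have h1 : 2 ^ 32 ≤ 2 ^ w := Nat.pow_le_pow_right (by norm_num) (by omega)
      rw [Nat.mod_eq_of_lt (a := 4294967295) (by omega)]
      conv_lhs => rw [← Nat.div_add_mod m 32, pow_add, pow_mul, Nat.mul_mod, Nat.pow_mod]
      have h2 : 2 ^ (m % 32) ≤ 2 ^ 31 :=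
        Nat.pow_le_pow_right (by norm_num) (by omega)
      norm_num
      omega
  rw [bucket, BitVec.toNat_udiv, BitVec.toNat_umod, BitVec.toNat_ofNat, hz, h,
    Nat.pow_div (Nat.mod_le _ _) (by norm_num)]
  congr 1
  omega

end Bits

/-! ### Boyer-Moore majority vote -/

section Majority

variable {α : Type} [DecidableEq α]

/-- How often `a` occurs among `v 0, …, v (n - 1)`. -/
def occurrences (v : ℕ → α) (n : ℕ) (a : α) : ℕ := ((Finset.range n).filter fun j => v j = a).card

theorem occurrences_succ (v : ℕ → α) (n : ℕ) (a : α) :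
    occurrences v (n + 1) a = occurrences v n a + if v n = a then 1 else 0 := by
  rw [occurrences, occurrences, Finset.range_add_one, Finset.filter_insert]
  split_ifs
  · rw [Finset.card_insert_of_notMem (by simp)]
  · rfl

/-- The three bounds are an invariant of the vote. When the lead is 0 they say that no value occurs
in more than half of the rounds, so any value may become the new candidate. The first bound makes
the lead a certificate for the candidate; the other two force a majority to win, with a large lead.
-/
theorem majority_spec [Zero α] (v : ℕ → α) (n : ℕ) :
    (majority v n).2 ≤ occurrences v n (majority v n).1 ∧
    2 * occurrences v n (majority v n).1 ≤ n + (majority v n).2 ∧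
    ∀ a, a ≠ (majority v n).1 → 2 * occurrences v n a + (majority v n).2 ≤ n := by
  induction n with
  | zero => exact ⟨Nat.zero_le _, le_rfl, fun _ _ => le_rfl⟩
  | succ n ih =>
    obtain ⟨h1, h2, h3⟩ := ih
    simp only [majority, vote, occurrences_succ]
    generalize majority v n = A at *
    by_cases h : A.2 = 0
    · simp only [h, if_true]
      refine ⟨by omega, ?_, fun a ha => ?_⟩
      · by_cases hA : v n = A.1
        · rw [hA]; omega
        · have := h3 _ hA; omega
      · rw [if_neg ha.symm]
        by_cases hA : a = A.1
        · rw [hA]; omega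
        · have := h3 _ hA; omega
    · by_cases h' : v n = A.1
      · simp only [h, h', if_false, if_true]
        refine ⟨by omega, by omega, fun a ha => ?_⟩
        have := h3 _ ha
        rw [if_neg ha.symm]
        omega
      · simp only [h, h', if_false]
        refine ⟨by omega, by omega, fun a ha => ?_⟩
        have := h3 _ ha
        split_ifs <;> omega

theorem majority_eq [Zero α] {v : ℕ → α} {n : ℕ} {a : α} (h : n < 2 * occurrences v n a) :
    (majority v n).1 = a ∧ 2 * occurrences v n a ≤ n + (majority v n).2 := by
  obtain ⟨-, h2, h3⟩ := majority_spec v n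
  by_cases ha : a = (majority v n).1
  · exact ⟨ha.symm, by rw [ha]; exact h2⟩
  · have := h3 a ha
    omega

theorem majority_zero [Zero α] {v : ℕ → α} {n : ℕ} (hv : ∀ j < n, v j = 0) : (majority v n).1 = 0 := by
  induction n with
  | zero => rfl
  | succ n ih =>
    have ih := ih fun j hj => hv j (by omega)
    simp only [majority, vote]
    split_ifs
    exacts [hv n (by omega), ih, ih]

end Majority

/-! ### Combining the two votes -/

section Winner

variable {w : ℕ}

/-- If in more than three quarters of the groups the lowest one is in a window of 16 positions, then
the winner is close to this window. -/
theorem winner_spec (hw : 2 ≤ w) {g : ℕ → BitVec w} {k lo hi : ℕ} {Good : ℕ → Prop}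
    [DecidablePred Good] (hhi : hi ≤ lo + 15)
    (hgood : ∀ j < k, Good j → ∃ m, lo ≤ m ∧ m ≤ hi ∧
      (lowBit (groupUpTo g j 256)).toNat = 2 ^ m)
    (hk : 3 * k < 4 * ((Finset.range k).filter Good).card) :
    ∃ r m, (winner g k).toNat = 2 ^ r ∧ r ≤ m ∧ m ≤ r + 47 ∧ lo ≤ m ∧ m ≤ hi := by
  rw [winner]
  have hall : ∀ (v : ℕ → BitVec w) (a : BitVec w), (∀ j < k, Good j → v j = a) →
      ((Finset.range k).filter Good).card ≤ occurrences v k a :=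
    fun v a hva => Finset.card_le_card fun j hj => by
      rw [Finset.mem_filter, Finset.mem_range] at hj ⊢
      exact ⟨hj.1, hva j hj.1 hj.2⟩
  split_ifs with h
  -- The winner has more than half of the ballots and more than three quarters of the groups are
  -- good, so some good group voted for it.
  · have h1 := (majority_spec (ballot g) k).1
    rw [occurrences] at h1
    obtain ⟨j, hj⟩ : (((Finset.range k).filter Good) ∩
        ((Finset.range k).filter fun j => ballot g j = (majority (ballot g) k).1)).Nonempty := by
      rw [← Finset.card_pos]
      have h2 := Finset.card_union_add_card_inter ((Finset.range k).filter Good)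
        ((Finset.range k).filter fun j => ballot g j = (majority (ballot g) k).1)
      have h3 : (((Finset.range k).filter Good) ∪
          ((Finset.range k).filter fun j => ballot g j = (majority (ballot g) k).1)).card ≤ k := by
        rw [← Finset.filter_or]
        exact (Finset.card_filter_le _ _).trans (Finset.card_range k).le
      omega
    simp only [Finset.mem_inter, Finset.mem_filter, Finset.mem_range] at hj
    obtain ⟨m, h2, h3, h4⟩ := hgood j hj.1.1 hj.1.2
    refine ⟨32 * (m / 32), m, ?_, by omega, by omega, h2, h3⟩
    rw [← hj.2.2, ballot, toNat_bucket hw h4]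
  -- Otherwise the window would lie between two multiples of 32. All good groups would then agree,
  -- and more than `3k/4` equal votes force a lead above `k/2`, against the case assumption.
  · have hlo : 17 ≤ lo % 32 := by
      by_contra hlo
      refine h ?_
      have := hall (ballot g) (BitVec.ofNat w (2 ^ (32 * (lo / 32)))) fun j hj hg => by
        obtain ⟨m, h2, h3, h4⟩ := hgood j hj hg
        have h5 : m / 32 = lo / 32 := by omega
        rw [← h5, ← toNat_bucket hw h4, BitVec.ofNat_toNat, BitVec.setWidth_eq, ballot]
      have := (majority_eq (v := ballot g) (n := k)
        (a := BitVec.ofNat w (2 ^ (32 * (lo / 32)))) (by omega)).2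
      omega
    -- Shifting by 16 moves such a window to remainders 1 to 30 modulo 32, so now all good groups
    -- agree. The shift also explains the 47, which is `31 + 16`.
    have hval : ∀ j < k, Good j →
        (ballotShifted g j).toNat = 2 ^ (32 * ((lo - 16) / 32)) := fun j hj hg => by
      obtain ⟨m, h2, h3, h4⟩ := hgood j hj hg
      have h5 : (lowBit (groupUpTo g j 256) >>> 16).toNat = 2 ^ (m - 16) := by
        rw [BitVec.toNat_ushiftRight, h4, Nat.shiftRight_eq_div_pow,
          Nat.pow_div (by omega) (by norm_num)]
      rw [ballotShifted, toNat_bucket hw h5]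
      congr 2
      omega
    obtain ⟨j, hj⟩ : ((Finset.range k).filter Good).Nonempty := by
      rw [← Finset.card_pos]; omega
    rw [Finset.mem_filter, Finset.mem_range] at hj
    have := hall (ballotShifted g) (ballotShifted g j) fun i hi hg =>
      BitVec.eq_of_toNat_eq (by rw [hval i hi hg, hval j hj.1 hj.2])
    have h6 := (majority_eq (v := ballotShifted g) (n := k) (a := ballotShifted g j) (by omega)).1
    obtain ⟨m, h2, h3, -⟩ := hgood j hj.1 hj.2
    exact ⟨_, m, by rw [h6, hval j hj.1 hj.2], by omega, by omega, h2, h3⟩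

theorem winner_zero {g : ℕ → BitVec w} (k : ℕ) (hg : ∀ j < k * 256, g j = 0) :
    winner g k = 0 := by
  have hY : ∀ j < k, ∀ n ≤ 256, groupUpTo g j n = 0 := by
    intro j hj n hn
    induction n with
    | zero => rfl
    | succ n ih => rw [groupUpTo, ih (by omega), hg _ (by omega)]; simp
  rw [winner, majority_zero, majority_zero, ite_self]
  · intro j hj
    rw [ballotShifted, hY j hj _ le_rfl]
    simp [lowBit, bucket]
  · intro j hj
    rw [ballot, hY j hj _ le_rfl]
    simp [lowBit, bucket]

end Winner

/-! ## Uniform probability -/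

section Prob

variable {Ω Ω' ι : Type} [Finite Ω] [Finite Ω']

theorem uniformProb_eq_sum [Fintype Ω] (E : Ω → Prop) [DecidablePred E] :
    uniformProb E = (∑ ω, if E ω then (1 : ℝ) else 0) / Fintype.card Ω := by
  rw [uniformProb, Nat.card_eq_fintype_card, Nat.card_eq_fintype_card, Fintype.card_subtype,
    Finset.sum_boole]

theorem uniformProb_mono {E F : Ω → Prop} (h : ∀ ω, E ω → F ω) :
    uniformProb E ≤ uniformProb F := by
  have := Nat.card_le_card_of_injective (fun x : {ω // E ω} => (⟨x.1, h _ x.2⟩ : {ω // F ω}))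
    fun x y hxy => Subtype.ext (congrArg (fun z : {ω // F ω} => z.1) hxy)
  rw [uniformProb, uniformProb]
  gcongr

theorem uniformProb_nonneg (E : Ω → Prop) : 0 ≤ uniformProb E := by
  rw [uniformProb]; positivity

theorem uniformProb_congr {E F : Ω → Prop} (h : ∀ ω, E ω ↔ F ω) :
    uniformProb E = uniformProb F := by
  rw [show E = F from funext fun ω => propext (h ω)]

theorem uniformProb_equiv (e : Ω ≃ Ω') (E : Ω' → Prop) :
    uniformProb (fun ω => E (e ω)) = uniformProb E := by
  rw [uniformProb, uniformProb, Nat.card_congr e]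
  congr 2
  exact Nat.card_congr (e.subtypeEquiv fun _ => Iff.rfl)

theorem uniformProb_not [Nonempty Ω] (E : Ω → Prop) :
    uniformProb (fun ω => ¬ E ω) = 1 - uniformProb E := by
  classical
  cases nonempty_fintype Ω
  have h : (Fintype.card Ω : ℝ) ≠ 0 := by positivity
  rw [uniformProb_eq_sum, uniformProb_eq_sum, eq_sub_iff_add_eq, ← add_div,
    ← Finset.sum_add_distrib, div_eq_one_iff_eq h, ← Finset.card_univ, Finset.card_eq_sum_ones]
  push_cast
  exact Finset.sum_congr rfl fun ω _ => by by_cases hE : E ω <;> simp [hE]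

theorem uniformProb_exists_le (s : Finset ι) (E : ι → Ω → Prop) :
    uniformProb (fun ω => ∃ i ∈ s, E i ω) ≤ ∑ i ∈ s, uniformProb (E i) := by
  classical
  cases nonempty_fintype Ω
  simp only [uniformProb_eq_sum]
  rw [← Finset.sum_div, Finset.sum_comm]
  gcongr with ω
  split_ifs with h
  · obtain ⟨i, hi, hE⟩ := h
    have := Finset.single_le_sum (f := fun i => if E i ω then (1 : ℝ) else 0)
      (fun j _ => by positivity) hi
    simpa [hE] using this
  · positivity

theorem uniformProb_or_le (E F : Ω → Prop) :
    uniformProb (fun ω => E ω ∨ F ω) ≤ uniformProb E + uniformProb F := by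
  have := uniformProb_exists_le (Finset.univ : Finset Bool) fun b => if b then E else F
  simpa [or_comm] using this

theorem uniformProb_prod (E : Ω → Prop) (F : Ω' → Prop) :
    uniformProb (fun ω : Ω × Ω' => E ω.1 ∧ F ω.2) = uniformProb E * uniformProb F := by
  rw [uniformProb, uniformProb, uniformProb, Nat.card_congr (Equiv.subtypeProdEquivProd),
    Nat.card_prod, Nat.card_prod, div_mul_div_comm]
  push_cast
  rfl

theorem uniformProb_pi [Nonempty Ω] [Fintype ι] (T : Finset ι) (E : Ω → Prop) :
    uniformProb (fun ω : ι → Ω => ∀ i ∈ T, E (ω i)) = uniformProb E ^ T.card := by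
  classical
  cases nonempty_fintype Ω
  have h : (Fintype.card Ω : ℝ) ≠ 0 := by positivity
  have h1 : Nat.card {ω : ι → Ω // ∀ i ∈ T, E (ω i)} =
      ∏ i, if i ∈ T then Nat.card {ω // E ω} else Nat.card Ω := by
    rw [Nat.card_congr (β := ∀ i, {a : Ω // i ∈ T → E a}) Equiv.subtypePiEquivPi, Nat.card_pi]
    refine Finset.prod_congr rfl fun i _ => ?_
    split_ifs with hi <;> simp [hi]
  rw [uniformProb, uniformProb, h1, Finset.prod_ite, Finset.prod_const, Finset.prod_const,
    Nat.card_pi, Finset.prod_const, Finset.card_univ, div_pow, ← Finset.card_univ]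
  have h2 : (Finset.univ.filter fun i => i ∈ T) = T := by ext; simp
  have h3 := Finset.card_filter_add_card_filter_not (s := Finset.univ) (fun i => i ∈ T)
  rw [h2] at h3 ⊢
  rw [← h3, pow_add]
  rw [Nat.card_eq_fintype_card (α := Ω)]
  push_cast
  field_simp

/-- The second moment method: among events that are nearly pairwise independent, an odd number
occurs with at least the following probability. -/
theorem le_uniformProb_odd [Nonempty Ω] (D : Finset ι) (E : ι → Ω → Prop)
    [∀ i ω, Decidable (E i ω)] {q c : ℝ} (h1 : ∀ i ∈ D, uniformProb (E i) = q)
    (h2 : ∀ i ∈ D, ∀ j ∈ D, i ≠ j → uniformProb (fun ω => E i ω ∧ E j ω) ≤ c) (hc : 0 ≤ c) :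
    D.card * q - D.card ^ 2 * c ≤ uniformProb fun ω => Odd (D.filter fun i => E i ω).card := by
  classical
  cases nonempty_fintype Ω
  have hpos : (0 : ℝ) < Fintype.card Ω := by positivity
  let N : Ω → ℝ := fun ω => ∑ i ∈ D, if E i ω then (1 : ℝ) else 0
  have hN : ∀ ω, N ω = ((D.filter fun i => E i ω).card : ℕ) := fun ω => by
    simp only [N, Finset.sum_boole]
  -- `2N - N² = 1 - (N - 1)²` is at most 1, and at most 0 for even `N`. Taking expectations leaves
  -- only first and second moments.
  have key : ∀ ω, 2 * N ω - N ω ^ 2 ≤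
      if Odd (D.filter fun i => E i ω).card then (1 : ℝ) else 0 := by
    intro ω
    rw [hN]
    generalize (D.filter fun i => E i ω).card = m
    split_ifs with hm
    · nlinarith [sq_nonneg ((m : ℝ) - 1)]
    · rcases Nat.eq_zero_or_pos m with rfl | hm0
      · simp
      · have : 2 ≤ m := by
          by_contra hlt
          obtain rfl : m = 1 := by omega
          exact hm odd_one
        have : (2 : ℝ) ≤ m := by exact_mod_cast this
        nlinarith
  have hsq : ∀ ω, N ω ^ 2 = ∑ i ∈ D, ∑ j ∈ D, if E i ω ∧ E j ω then (1 : ℝ) else 0 := fun ω => by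
    simp only [N, sq, Finset.sum_mul_sum]
    refine Finset.sum_congr rfl fun i _ => Finset.sum_congr rfl fun j _ => ?_
    by_cases hi : E i ω <;> by_cases hj : E j ω <;> simp [hi, hj]
  have e1 : (∑ ω, N ω) / Fintype.card Ω = D.card * q := by
    simp only [N]
    rw [Finset.sum_comm, Finset.sum_div, ← nsmul_eq_mul, ← Finset.sum_const]
    refine Finset.sum_congr rfl fun i hi => ?_
    rw [← h1 i hi, uniformProb_eq_sum]
  have e2 : (∑ ω, N ω ^ 2) / Fintype.card Ω ≤ D.card * q + D.card ^ 2 * c := by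
    simp only [hsq]
    rw [Finset.sum_comm, Finset.sum_div]
    have : ∀ i ∈ D, (∑ ω, ∑ j ∈ D, if E i ω ∧ E j ω then (1 : ℝ) else 0) / Fintype.card Ω ≤
        q + D.card * c := by
      intro i hi
      rw [Finset.sum_comm, Finset.sum_div, ← Finset.add_sum_erase _ _ hi]
      gcongr
      · rw [← h1 i hi, uniformProb_eq_sum]
        simp
      · calc _ ≤ ∑ j ∈ D.erase i, c := by
              refine Finset.sum_le_sum fun j hj => ?_
              rw [Finset.mem_erase] at hj
              have := h2 i hi j hj.2 hj.1.symm
              rwa [uniformProb_eq_sum] at this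
          _ = (D.erase i).card * c := by rw [Finset.sum_const, nsmul_eq_mul]
          _ ≤ D.card * c := by
              gcongr
              exact Finset.erase_subset _ _
    refine (Finset.sum_le_sum this).trans ?_
    rw [Finset.sum_const, nsmul_eq_mul]
    apply le_of_eq
    ring
  rw [uniformProb_eq_sum]
  calc D.card * q - D.card ^ 2 * c
      ≤ 2 * ((∑ ω, N ω) / Fintype.card Ω) - (∑ ω, N ω ^ 2) / Fintype.card Ω := by
        rw [e1]; linarith
    _ = (∑ ω, (2 * N ω - N ω ^ 2)) / Fintype.card Ω := by
        rw [Finset.sum_sub_distrib, ← Finset.mul_sum]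
        ring
    _ ≤ _ := by
        gcongr with ω
        exact key ω

end Prob

/-! ## Multiply-shift hashing -/

section Hashing

/-- If `z` is positive and less than `M`, a power of two, then the high digit in base `M` of the
product of `z` and a two-digit number is uniformly distributed. -/
theorem card_mul_div_eq {w M z : ℕ} [NeZero M] [NeZero (M * M)] (hM : M = 2 ^ w) (hz : 0 < z)
    (hzw : z < M) (γ : ZMod M) :
    (Finset.univ.filter fun A : ZMod (M * M) =>
      ((A.val * z / M : ℕ) : ZMod M) = γ).card = M := by
  have hM0 : 0 < M := Nat.pos_of_neZero M
  let D : ZMod (M * M) → ZMod M := fun A => ((A.val * z / M : ℕ) : ZMod M)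
  -- As `0 < z < M` and `M` is a power of two, `gcd z (M * M)` is a power of two dividing `M`;
  -- Bézout gives the solution.
  obtain ⟨A₀, hA₀⟩ : ∃ A₀ : ZMod (M * M), A₀ * (z : ZMod (M * M)) = (M : ZMod (M * M)) := by
    have hg : Nat.gcd z (M * M) ∣ M := by
      have h1 : Nat.gcd z (M * M) ∣ 2 ^ (w + w) := by
        rw [pow_add, ← hM]; exact Nat.gcd_dvd_right _ _
      obtain ⟨s, -, hs⟩ := (Nat.dvd_prime_pow Nat.prime_two).1 h1
      rw [hs, hM]
      apply Nat.pow_dvd_pow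
      have h2 := Nat.le_of_dvd hz (Nat.gcd_dvd_left z (M * M))
      rw [hs] at h2
      rw [hM] at hzw
      exact ((Nat.pow_lt_pow_iff_right (by norm_num : 1 < 2)).1 (h2.trans_lt hzw)).le
    obtain ⟨c, hc⟩ := hg
    refine ⟨(Nat.gcdA z (M * M) * c : ℤ), ?_⟩
    have h3 := Nat.gcd_eq_gcd_ab z (M * M)
    have h4 := congrArg (Int.cast : ℤ → ZMod (M * M)) h3
    push_cast at h4 ⊢
    have h5 : (M : ZMod (M * M)) * (M : ZMod (M * M)) = 0 := by
      rw [← Nat.cast_mul, ZMod.natCast_self]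
    rw [h5, zero_mul, add_zero] at h4
    have h6 := congrArg (Nat.cast : ℕ → ZMod (M * M)) hc
    push_cast at h6
    rw [h6, h4]
    ring
  -- Translation by `A₀` adds `M` to the product, hence 1 to its high digit. It therefore permutes
  -- the fibres of `D` cyclically, and they all have the same size.
  have hD : ∀ A, D (A + A₀) = D A + 1 := by
    intro A
    have h1 : (((A + A₀).val * z : ℕ) : ZMod (M * M)) = ((A.val * z + M : ℕ) : ZMod (M * M)) := by
      push_cast
      rw [ZMod.natCast_zmod_val, ZMod.natCast_zmod_val, add_mul, hA₀]
    rw [ZMod.natCast_eq_natCast_iff'] at h1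
    have h2 : ∀ n : ℕ, ((n / M : ℕ) : ZMod M) = ((n % (M * M) / M : ℕ) : ZMod M) := fun n => by
      rw [Nat.mod_mul_right_div_self, ZMod.natCast_mod]
    simp only [D]
    rw [h2, h1, ← h2, Nat.add_div_right _ hM0]
    push_cast
    rfl
  have hstep : ∀ γ, (Finset.univ.filter fun A => D A = γ + 1).card =
      (Finset.univ.filter fun A => D A = γ).card := by
    intro γ
    symm
    refine Finset.card_bij (fun A _ => A + A₀) (fun A hA => ?_) (fun A _ B _ h => by simpa using h)
      fun B hB => ⟨B - A₀, ?_, by simp⟩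
    · simp only [Finset.mem_filter, Finset.mem_univ, true_and] at hA ⊢
      rw [hD, hA]
    · simp only [Finset.mem_filter, Finset.mem_univ, true_and] at hB ⊢
      have := hD (B - A₀)
      rw [sub_add_cancel, hB] at this
      exact (add_right_cancel this).symm
  have hconst : ∀ γ, (Finset.univ.filter fun A => D A = γ).card =
      (Finset.univ.filter fun A => D A = 0).card := by
    intro γ
    rw [← ZMod.natCast_zmod_val γ]
    induction γ.val with
    | zero => simp
    | succ n ih => rw [Nat.cast_succ, hstep, ih]
  have hsum := Finset.card_eq_sum_card_fiberwise (s := Finset.univ) (t := Finset.univ) (f := D)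
    (fun _ _ => Finset.mem_coe.2 (Finset.mem_univ _))
  rw [Finset.sum_congr rfl fun γ _ => hconst γ, Finset.sum_const, Finset.card_univ,
    Finset.card_univ, ZMod.card, ZMod.card, smul_eq_mul] at hsum
  change (Finset.univ.filter fun A => D A = γ).card = M
  rw [hconst]
  exact (Nat.eq_of_mul_eq_mul_left hM0 hsum).symm

/-- The residue class of a word. -/
def residue {w : ℕ} (v : BitVec w) : ZMod (2 ^ w) := (v.toNat : ZMod (2 ^ w))

theorem residue_injective {w : ℕ} : Function.Injective (residue (w := w)) := by
  intro a b h
  rw [residue, residue, ZMod.natCast_eq_natCast_iff', Nat.mod_eq_of_lt a.isLt,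
    Nat.mod_eq_of_lt b.isLt] at h
  exact BitVec.eq_of_toNat_eq h

/-- The `mulhi` term is the carry from the low half of the multiplier, so the two multiplications
give the second word of the long product. -/
theorem residue_hashWord {w : ℕ} (a₁ a₀ b x : BitVec w) :
    residue (hashWord a₁ a₀ b x) =
      (((a₁.toNat * 2 ^ w + a₀.toNat) * x.toNat / 2 ^ w : ℕ) : ZMod (2 ^ w)) + residue b := by
  have h : (a₁.toNat * 2 ^ w + a₀.toNat) * x.toNat / 2 ^ w =
      a₁.toNat * x.toNat + a₀.toNat * x.toNat / 2 ^ w := by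
    rw [show (a₁.toNat * 2 ^ w + a₀.toNat) * x.toNat =
      2 ^ w * (a₁.toNat * x.toNat) + a₀.toNat * x.toNat by ring,
      Nat.mul_add_div (by positivity)]
  rw [h, residue, residue, hashWord, BitVec.toNat_add, BitVec.toNat_add, BitVec.toNat_mul,
    BitVec.toNat_ofNat, ZMod.natCast_mod]
  push_cast [ZMod.natCast_mod]
  rfl

/-- Subtracting the two equations eliminates `b` and, up to a carry, prescribes the high digit of
the multiplier times `x - y`. By `card_mul_div_eq` each carry leaves `2 ^ w` multipliers. Exact
pairwise independence would allow `2 ^ w` keys; the unknown carry costs the factor 2. -/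
theorem card_hash_pair_le {w : ℕ} {x y : BitVec w} (hxy : y.toNat < x.toNat) (α β : BitVec w) :
    (Finset.univ.filter fun p : BitVec w × BitVec w × BitVec w =>
      hashWord p.1 p.2.1 p.2.2 x = α ∧ hashWord p.1 p.2.1 p.2.2 y = β).card ≤ 2 * 2 ^ w := by
  have hM0 : 0 < 2 ^ w := by positivity
  have : NeZero (2 ^ w) := ⟨hM0.ne'⟩
  have : NeZero (2 ^ w * 2 ^ w) := ⟨(Nat.mul_pos hM0 hM0).ne'⟩
  let z := x.toNat - y.toNat
  have hz : 0 < z := Nat.sub_pos_of_lt hxy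
  have hzM : z < 2 ^ w := (Nat.sub_le _ _).trans_lt x.isLt
  let γ : ZMod (2 ^ w) := residue α - residue β
  let S : ZMod (2 ^ w) → Finset (ZMod (2 ^ w * 2 ^ w)) := fun γ =>
    Finset.univ.filter fun A => ((A.val * z / 2 ^ w : ℕ) : ZMod (2 ^ w)) = γ
  let pr : BitVec w × BitVec w × BitVec w → ℕ := fun p => p.1.toNat * 2 ^ w + p.2.1.toNat
  have hpr : ∀ p, pr p < 2 ^ w * 2 ^ w := fun p => by
    have h1 := p.1.isLt
    have h2 := p.2.1.isLt
    have h3 := Nat.mul_le_mul_right (2 ^ w) (Nat.succ_le_of_lt h1)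
    rw [Nat.succ_mul] at h3
    simp only [pr]
    omega
  have hval : ∀ p, ((pr p : ℕ) : ZMod (2 ^ w * 2 ^ w)).val = pr p := fun p =>
    ZMod.val_cast_of_lt (hpr p)
  calc _ ≤ (S γ ∪ S (γ - 1)).card := by
        refine Finset.card_le_card_of_injOn (fun p => ((pr p : ℕ) : ZMod (2 ^ w * 2 ^ w))) ?_ ?_
        · intro p hp
          simp only [Finset.coe_filter, Finset.mem_univ, true_and, Set.mem_ofPred_eq] at hp
          have h1 := congrArg residue hp.1
          have h2 := congrArg residue hp.2
          rw [residue_hashWord] at h1 h2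
          have h3 : ((pr p * x.toNat / 2 ^ w : ℕ) : ZMod (2 ^ w)) =
              ((pr p * y.toNat / 2 ^ w : ℕ) : ZMod (2 ^ w)) + γ := by
            simp only [γ, ← h1, ← h2, pr]
            ring
          have h4 : pr p * x.toNat = pr p * z + pr p * y.toNat := by
            rw [← mul_add, Nat.sub_add_cancel hxy.le]
          simp only [S, Finset.coe_union, Set.mem_union, Finset.mem_coe, Finset.mem_filter,
            Finset.mem_univ, true_and, hval]
          rw [h4, Nat.add_div hM0] at h3
          push_cast at h3
          split_ifs at h3
          · right
            rw [eq_sub_iff_add_eq]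
            apply add_right_cancel (b := ((pr p * y.toNat / 2 ^ w : ℕ) : ZMod (2 ^ w)))
            rw [add_comm γ, ← h3]
            ring
          · left
            apply add_right_cancel (b := ((pr p * y.toNat / 2 ^ w : ℕ) : ZMod (2 ^ w)))
            rw [add_comm γ, ← h3]
            ring
        -- The multiplier and the hash value of `x` determine `b`, so counting multipliers suffices.
        · intro p hp p' hp' h
          simp only [Finset.coe_filter, Finset.mem_univ, true_and, Set.mem_ofPred_eq] at hp hp'
          have h0 := congrArg ZMod.val h
          simp only [hval] at h0
          have h1 := congrArg residue hp.1
          have h1' := congrArg residue hp'.1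
          rw [residue_hashWord] at h1 h1'
          have h2 : residue p.2.2 = residue p'.2.2 := by
            rw [← h1'] at h1
            simp only [pr] at h0
            rw [h0] at h1
            exact add_left_cancel h1
          simp only [pr] at h0
          have e1 := congrArg (· / 2 ^ w) h0
          have e2 := congrArg (· % 2 ^ w) h0
          simp only [Nat.mul_comm _ (2 ^ w), Nat.mul_add_div hM0, Nat.mul_add_mod,
            Nat.mod_eq_of_lt p.2.1.isLt, Nat.mod_eq_of_lt p'.2.1.isLt,
            Nat.div_eq_of_lt p.2.1.isLt, Nat.div_eq_of_lt p'.2.1.isLt, add_zero] at e1 e2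
          exact Prod.ext (BitVec.eq_of_toNat_eq e1)
            (Prod.ext (BitVec.eq_of_toNat_eq e2) (residue_injective h2))
    _ ≤ (S γ).card + (S (γ - 1)).card := Finset.card_union_le _ _
    _ = 2 * 2 ^ w := by
        rw [card_mul_div_eq rfl hz hzM, card_mul_div_eq rfl hz hzM, two_mul]

end Hashing

/-! ## Probabilities of hits -/

section Hits

variable {w : ℕ}

theorem uniformProb_true {Ω : Type} [Finite Ω] [Nonempty Ω] :
    uniformProb (fun _ : Ω => True) = 1 := by
  have : (Nat.card Ω : ℝ) ≠ 0 := by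
    have := Nat.card_pos (α := Ω)
    positivity
  rw [uniformProb, Nat.card_congr (Equiv.subtypeUnivEquiv fun _ => trivial), div_self this]

theorem uniformProb_snd {Ω Ω' : Type} [Finite Ω] [Finite Ω'] [Nonempty Ω] (E : Ω' → Prop) :
    uniformProb (fun ω : Ω × Ω' => E ω.2) = uniformProb E := by
  have := uniformProb_prod (fun _ : Ω => True) E
  simpa [uniformProb_true] using this

/-- Words as numbers below `2 ^ w`. -/
def bitVecEquivFin (w : ℕ) : BitVec w ≃ Fin (2 ^ w) :=
  ⟨BitVec.toFin, BitVec.ofFin, fun _ => rfl, fun _ => rfl⟩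

theorem card_bitVec (w : ℕ) : Nat.card (BitVec w) = 2 ^ w := by
  rw [Nat.card_congr (bitVecEquivFin w), Nat.card_eq_fintype_card, Fintype.card_fin]

/-- For a fixed multiplier, the uniform summand `b` makes the hash value uniform; `e` replaces `b`
by that value. -/
theorem uniformProb_hash (E : BitVec w → Prop) (x : BitVec w) :
    uniformProb (fun p : BitVec w × BitVec w × BitVec w => E (hashWord p.1 p.2.1 p.2.2 x)) =
      uniformProb E := by
  let e : BitVec w × BitVec w × BitVec w ≃ BitVec w × BitVec w × BitVec w :=
    { toFun := fun p => (p.1, p.2.1, hashWord p.1 p.2.1 p.2.2 x)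
      invFun := fun p => (p.1, p.2.1, p.2.2 - hashWord p.1 p.2.1 0 x)
      left_inv := fun p => by simp [hashWord, BitVec.add_comm]
      right_inv := fun p => by simp [hashWord, BitVec.add_comm _ (p.2.2 - _)] }
  exact (uniformProb_equiv e fun p => E p.2.2).trans
    ((uniformProb_snd fun p : BitVec w × BitVec w => E p.2).trans (uniformProb_snd E))

theorem uniformProb_hash_pair_le (E : BitVec w → Prop) {x y : BitVec w} (hxy : x ≠ y) :
    uniformProb (fun p : BitVec w × BitVec w × BitVec w =>
      E (hashWord p.1 p.2.1 p.2.2 x) ∧ E (hashWord p.1 p.2.1 p.2.2 y)) ≤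
        2 * uniformProb E ^ 2 := by
  classical
  wlog hlt : y.toNat < x.toNat generalizing x y
  · have hne : x.toNat ≠ y.toNat := fun h => hxy (BitVec.eq_of_toNat_eq h)
    rw [uniformProb_congr fun p => and_comm]
    exact this hxy.symm (by omega)
  let S := Finset.univ.filter E
  have hcount : (Finset.univ.filter fun p : BitVec w × BitVec w × BitVec w =>
      E (hashWord p.1 p.2.1 p.2.2 x) ∧ E (hashWord p.1 p.2.1 p.2.2 y)).card ≤
      S.card * S.card * (2 * 2 ^ w) := by
    rw [Finset.card_eq_sum_card_fiberwise (t := S ×ˢ S)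
      (f := fun p => (hashWord p.1 p.2.1 p.2.2 x, hashWord p.1 p.2.1 p.2.2 y)),
      ← Finset.card_product, ← smul_eq_mul]
    · refine Finset.sum_le_card_nsmul _ _ _ fun q _ => ?_
      refine (Finset.card_le_card fun p hp => ?_).trans (card_hash_pair_le hlt q.1 q.2)
      simp only [Finset.mem_filter, Finset.mem_univ, true_and] at hp ⊢
      rw [← hp.2]
      exact ⟨rfl, rfl⟩
    · intro p hp
      simpa [S] using hp
  have hS : uniformProb E = S.card / 2 ^ w := by
    rw [uniformProb, Nat.card_eq_fintype_card, Fintype.card_subtype, card_bitVec]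
    push_cast
    rfl
  rw [uniformProb, hS, Nat.card_prod, Nat.card_prod, card_bitVec,
    Nat.card_eq_fintype_card, Fintype.card_subtype, div_le_iff₀ (by positivity)]
  have h2 : ((Finset.univ.filter fun p : BitVec w × BitVec w × BitVec w =>
      E (hashWord p.1 p.2.1 p.2.2 x) ∧ E (hashWord p.1 p.2.1 p.2.2 y)).card : ℝ) ≤
      S.card * S.card * (2 * 2 ^ w) := by exact_mod_cast hcount
  refine h2.trans (le_of_eq ?_)
  push_cast
  field_simp

theorem uniformProb_mod {i r : ℕ} (hi : i ≤ w) (hr : r < 2 ^ i) :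
    uniformProb (fun z : BitVec w => z.toNat % 2 ^ i = r) = 1 / 2 ^ i := by
  let e : BitVec w ≃ Fin (2 ^ (w - i)) × Fin (2 ^ i) :=
    (bitVecEquivFin w).trans
      ((finCongr (by rw [← pow_add, Nat.sub_add_cancel hi])).trans finProdFinEquiv.symm)
  have he : ∀ z : BitVec w, z.toNat % 2 ^ i = r ↔ (e z).2 = ⟨r, hr⟩ := fun z => by
    rw [Fin.ext_iff]
    rfl
  rw [uniformProb_congr he, uniformProb_equiv e fun p => p.2 = ⟨r, hr⟩,
    uniformProb_snd fun b : Fin (2 ^ i) => b = ⟨r, hr⟩, uniformProb]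
  simp

/-- The two triples among six coins. -/
def coinTriples (α : Type) : (Fin 6 → α) ≃ (α × α × α) × (α × α × α) where
  toFun φ := ((φ 0, φ 1, φ 2), (φ 3, φ 4, φ 5))
  invFun p := ![p.1.1, p.1.2.1, p.1.2.2, p.2.1, p.2.2.1, p.2.2.2]
  left_inv φ := by
    funext i
    match i with
    | 0 | 1 | 2 | 3 | 4 | 5 => rfl
  right_inv _ := rfl

theorem uniformProb_sampled (hw : 4 ≤ w) :
    uniformProb (fun z : BitVec w => z.toNat % 16 = 0) = 1 / 2 ^ 4 := by
  have h := uniformProb_mod (w := w) (i := 4) (r := 0) hw (by norm_num)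
  rwa [show (2 : ℕ) ^ 4 = 16 by norm_num] at h

theorem uniformProb_hit {i : ℕ} (hw : 4 ≤ w) (hi : i < w) (x : BitVec w) :
    uniformProb (fun φ => Hit φ x i) = 1 / 2 ^ (i + 5) := by
  have h := uniformProb_equiv (coinTriples (BitVec w)) fun p =>
    HasLevel (hashWord p.1.1 p.1.2.1 p.1.2.2 x) i ∧
      (hashWord p.2.1 p.2.2.1 p.2.2.2 x).toNat % 16 = 0
  refine h.trans ?_
  rw [uniformProb_prod (fun p : BitVec w × BitVec w × BitVec w => HasLevel (hashWord p.1 p.2.1 p.2.2 x) i)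
      (fun p : BitVec w × BitVec w × BitVec w => (hashWord p.1 p.2.1 p.2.2 x).toNat % 16 = 0),
    uniformProb_hash (fun z => HasLevel z i), uniformProb_hash (fun z => z.toNat % 16 = 0),
    uniformProb_sampled hw, show (fun z : BitVec w => HasLevel z i) =
      fun z => z.toNat % 2 ^ (i + 1) = 2 ^ i from rfl,
    uniformProb_mod hi (Nat.pow_lt_pow_right (by norm_num) (by omega))]
  rw [show i + 5 = i + 1 + 4 by ring, pow_add _ (i + 1)]
  field_simp

/-- Level and sampling use independent hash functions. Each loses a factor 2 against independence,
hence the 4. -/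
theorem uniformProb_hit_pair_le {i : ℕ} (hw : 4 ≤ w) (hi : i < w) {x y : BitVec w} (hxy : x ≠ y) :
    uniformProb (fun φ => Hit φ x i ∧ Hit φ y i) ≤ 4 * (1 / 2 ^ (i + 5)) ^ 2 := by
  have h := uniformProb_equiv (coinTriples (BitVec w)) fun p =>
    (HasLevel (hashWord p.1.1 p.1.2.1 p.1.2.2 x) i ∧
      HasLevel (hashWord p.1.1 p.1.2.1 p.1.2.2 y) i) ∧
    ((hashWord p.2.1 p.2.2.1 p.2.2.2 x).toNat % 16 = 0 ∧
      (hashWord p.2.1 p.2.2.1 p.2.2.2 y).toNat % 16 = 0)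
  have h' : uniformProb (fun φ => Hit φ x i ∧ Hit φ y i) = _ :=
    (uniformProb_congr fun φ => and_and_and_comm).trans h
  have h1 := uniformProb_hash_pair_le (fun z => HasLevel z i) hxy
  have h2 := uniformProb_hash_pair_le (fun z => z.toNat % 16 = 0) hxy
  rw [h', uniformProb_prod (fun p : BitVec w × BitVec w × BitVec w => HasLevel (hashWord p.1 p.2.1 p.2.2 x) i ∧
      HasLevel (hashWord p.1 p.2.1 p.2.2 y) i)
      (fun p : BitVec w × BitVec w × BitVec w => (hashWord p.1 p.2.1 p.2.2 x).toNat % 16 = 0 ∧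
        (hashWord p.1 p.2.1 p.2.2 y).toNat % 16 = 0)]
  refine (mul_le_mul h1 h2 (uniformProb_nonneg _) (by positivity)).trans (le_of_eq ?_)
  rw [uniformProb_sampled hw, show (fun z : BitVec w => HasLevel z i) =
      fun z => z.toNat % 2 ^ (i + 1) = 2 ^ i from rfl,
    uniformProb_mod hi (Nat.pow_lt_pow_right (by norm_num) (by omega)),
    show i + 5 = i + 1 + 4 by ring, pow_add _ (i + 1)]
  field_simp
  norm_num

/-- The element `x` is sampled and its level is at least `i`. -/
def Deep (φ : Fin 6 → BitVec w) (x : BitVec w) (i : ℕ) : Prop :=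
  (hashWord (φ 0) (φ 1) (φ 2) x).toNat % 2 ^ i = 0 ∧
    (hashWord (φ 3) (φ 4) (φ 5) x).toNat % 16 = 0

/-- All levels from `i` on are covered by one event, so that the union bound runs over fields and
elements only. -/
theorem Hit.deep {φ : Fin 6 → BitVec w} {x : BitVec w} {i j : ℕ} (h : Hit φ x j) (hij : i ≤ j) :
    Deep φ x i := by
  refine ⟨Nat.mod_eq_zero_of_dvd ?_, h.2⟩
  have h1 : 2 ^ i ∣ 2 ^ (j + 1) := Nat.pow_dvd_pow 2 (by omega)
  rw [← Nat.dvd_mod_iff h1, show _ % _ = _ from h.1]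
  exact Nat.pow_dvd_pow 2 hij

theorem uniformProb_deep {i : ℕ} (hw : 4 ≤ w) (hi : i ≤ w) (x : BitVec w) :
    uniformProb (fun φ => Deep φ x i) = 1 / 2 ^ (i + 4) := by
  have h := uniformProb_equiv (coinTriples (BitVec w)) fun p =>
    (hashWord p.1.1 p.1.2.1 p.1.2.2 x).toNat % 2 ^ i = 0 ∧
      (hashWord p.2.1 p.2.2.1 p.2.2.2 x).toNat % 16 = 0
  refine h.trans ?_
  rw [uniformProb_prod (fun p : BitVec w × BitVec w × BitVec w => (hashWord p.1 p.2.1 p.2.2 x).toNat % 2 ^ i = 0)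
      (fun p : BitVec w × BitVec w × BitVec w => (hashWord p.1 p.2.1 p.2.2 x).toNat % 16 = 0),
    uniformProb_hash (fun z => z.toNat % 2 ^ i = 0), uniformProb_hash (fun z => z.toNat % 16 = 0),
    uniformProb_sampled hw, uniformProb_mod hi (by positivity), pow_add]
  field_simp

end Hits

/-! ## Groups of 256 fields -/

section Groups

variable {w u : ℕ}

/-- For a set of `d` elements, some field of the group has an odd number of elements of a level close
to `log d`, and no field has an element of a level much larger than this. -/
def GoodGroup (L : ℕ) (D : Finset (Fin u)) (ψ : Fin 256 → Fin 6 → BitVec w) : Prop :=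
  (∃ s, Odd (D.filter fun x : Fin u => Hit (ψ s) (BitVec.ofNat w (x : ℕ)) (Nat.clog 2 D.card - 2)).card) ∧
    (Nat.clog 2 D.card + 13 < L →
      ∀ s, ∀ x ∈ D, ¬ Deep (ψ s) (BitVec.ofNat w (x : ℕ)) (Nat.clog 2 D.card + 13))

theorem two_pow_clog_le {d : ℕ} (hd : 0 < d) : 2 ^ Nat.clog 2 d ≤ 2 * d := by
  rcases Nat.lt_or_ge 1 d with h | h
  · have h1 := Nat.pow_pred_clog_lt_self (b := 2) (by norm_num) h
    have h2 := Nat.clog_pos (b := 2) (by norm_num) h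
    obtain ⟨c, hc⟩ := Nat.exists_eq_succ_of_ne_zero h2.ne'
    rw [hc] at h1 ⊢
    rw [pow_succ]
    simp only [Nat.pred_succ] at h1
    omega
  · obtain rfl : d = 1 := by omega
    simp

/-- With `t` the expected number of hits, `le_uniformProb_odd` gives `t - 4t²`, which is at least
7/256 for `t` in `[1/32, 1/8]`. Sampling at rate 1/16 keeps `t` at most 1/8 even when `d` is small
and level 0 must be used. -/
theorem le_uniformProb_odd_hit {D : Finset (Fin u)} (hw : 4 ≤ w) (hu : u ≤ 2 ^ w)
    (hD : 0 < D.card) (hi : Nat.clog 2 D.card - 2 < w) :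
    7 / 256 ≤ uniformProb fun φ : Fin 6 → BitVec w =>
      Odd (D.filter fun x : Fin u => Hit φ (BitVec.ofNat w (x : ℕ)) (Nat.clog 2 D.card - 2)).card := by
  have h := le_uniformProb_odd D
    (fun (x : Fin u) (φ : Fin 6 → BitVec w) =>
      Hit φ (BitVec.ofNat w (x : ℕ)) (Nat.clog 2 D.card - 2))
    (fun x _ => uniformProb_hit hw hi _)
    (fun x _ y _ hxy => uniformProb_hit_pair_le hw hi fun he => hxy
      (Fin.ext (BitVec.ofNat_inj_of_lt (x.2.trans_le hu) (y.2.trans_le hu) he))) (by positivity)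
  refine le_trans ?_ h
  set d := D.card
  set q : ℝ := 1 / 2 ^ (Nat.clog 2 d - 2 + 5) with hq
  have hd1 := two_pow_clog_le hD
  have hd2 : d ≤ 2 ^ Nat.clog 2 d := Nat.le_pow_clog (by norm_num) d
  have ht : 1 / 32 ≤ (d : ℝ) * q ∧ (d : ℝ) * q ≤ 1 / 8 := by
    rw [hq, mul_one_div, div_le_div_iff₀ (by norm_num) (by positivity),
      div_le_div_iff₀ (by positivity) (by norm_num)]
    have hle : 2 ^ (Nat.clog 2 d - 2 + 5) ≤ d * 32 ∧ d * 8 ≤ 2 ^ (Nat.clog 2 d - 2 + 5) := by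
      -- In the first case the subtraction is truncated, the level is 0, and `d` is 1 or 2.
      rcases Nat.lt_or_ge (Nat.clog 2 d) 2 with h2 | h2
      · rw [Nat.sub_eq_zero_of_le h2.le]
        have : 2 ^ Nat.clog 2 d ≤ 2 ^ 1 := Nat.pow_le_pow_right (by norm_num) (by omega)
        omega
      · rw [show Nat.clog 2 d - 2 + 5 = Nat.clog 2 d + 3 by omega, pow_add]
        omega
    constructor
    · rw [one_mul]; exact_mod_cast hle.1
    · rw [one_mul]; exact_mod_cast hle.2
  have e : (d : ℝ) * q - (d : ℝ) ^ 2 * (4 * q ^ 2) = d * q - 4 * (d * q) ^ 2 := by ring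
  rw [e]
  -- `t - 4t² - 7/256 = 4 (t - 1/32) (7/32 - t)`.
  nlinarith [mul_nonneg (sub_nonneg.2 ht.1) (sub_nonneg.2 (ht.2.trans (by norm_num : (1 / 8 : ℝ) ≤ 7 / 32)))]

theorem uniformProb_not_goodGroup_le {L : ℕ} {D : Finset (Fin u)} (hw : 4 ≤ w) (hu : u ≤ 2 ^ w)
    (hL : L ≤ w) (hD : 0 < D.card) (hi : Nat.clog 2 D.card - 2 < w) :
    uniformProb (fun ψ : Fin 256 → Fin 6 → BitVec w => ¬ GoodGroup L D ψ) ≤ 1 / 256 := by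
  classical
  let O : (Fin 6 → BitVec w) → Prop := fun φ =>
    Odd (D.filter fun x : Fin u => Hit φ (BitVec.ofNat w (x : ℕ)) (Nat.clog 2 D.card - 2)).card
  have h1 : uniformProb (fun ψ : Fin 256 → Fin 6 → BitVec w => ∀ s ∈ Finset.univ, ¬ O (ψ s)) ≤
      1 / 512 := by
    rw [uniformProb_pi Finset.univ fun φ => ¬ O φ, uniformProb_not, Finset.card_univ, Fintype.card_fin]
    have h := le_uniformProb_odd_hit hw hu hD hi
    have h0 : 0 ≤ 1 - uniformProb O := by
      rw [← uniformProb_not]; exact uniformProb_nonneg _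
    calc (1 - uniformProb O) ^ 256 ≤ (249 / 256) ^ 256 := by
          apply pow_le_pow_left₀ h0
          linarith
      _ ≤ 1 / 512 := by norm_num
  -- The union bound has `256 * d` terms of at most `2 ^ (-(⌈log₂ d⌉ + 17))`, and `2 ^ (8 - 17) =
  -- 1/512`.
  have h2 : uniformProb (fun ψ : Fin 256 → Fin 6 → BitVec w => ∃ sx ∈ Finset.univ ×ˢ D,
      Nat.clog 2 D.card + 13 < L ∧
      Deep (ψ sx.1) (BitVec.ofNat w (sx.2 : ℕ)) (Nat.clog 2 D.card + 13)) ≤ 1 / 512 := by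
    refine (uniformProb_exists_le _ _).trans ?_
    have hp : ∀ sx ∈ (Finset.univ : Finset (Fin 256)) ×ˢ D,
        uniformProb (fun ψ : Fin 256 → Fin 6 → BitVec w => Nat.clog 2 D.card + 13 < L ∧
          Deep (ψ sx.1) (BitVec.ofNat w (sx.2 : ℕ)) (Nat.clog 2 D.card + 13)) ≤
        1 / 2 ^ (Nat.clog 2 D.card + 17) := by
      intro sx _
      by_cases hlt : Nat.clog 2 D.card + 13 < L
      · have := uniformProb_pi (ι := Fin 256) {sx.1} fun φ : Fin 6 → BitVec w =>
          Deep φ (BitVec.ofNat w (sx.2 : ℕ)) (Nat.clog 2 D.card + 13)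
        simp only [Finset.mem_singleton, forall_eq, Finset.card_singleton, pow_one] at this
        simp only [hlt, true_and]
        rw [this, uniformProb_deep hw (by omega)]
      · simp only [hlt, false_and]
        rw [uniformProb]
        simp
    refine (Finset.sum_le_sum hp).trans ?_
    rw [Finset.sum_const, Finset.card_product, Finset.card_univ, Fintype.card_fin, nsmul_eq_mul,
      mul_one_div, div_le_div_iff₀ (by positivity) (by norm_num), pow_add]
    have : (D.card : ℝ) ≤ 2 ^ Nat.clog 2 D.card := by
      exact_mod_cast Nat.le_pow_clog (by norm_num) D.card
    push_cast
    linarith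
  refine (uniformProb_mono fun ψ hψ => ?_).trans
    ((uniformProb_or_le _ _).trans ((add_le_add h1 h2).trans (by norm_num)))
  rw [GoodGroup, not_and_or] at hψ
  rcases hψ with hψ | hψ
  · left
    intro s _ ho
    exact hψ ⟨s, ho⟩
  · right
    push Not at hψ
    obtain ⟨hlt, s, x, hx, hd⟩ := hψ
    exact ⟨(s, x), by simp [hx], hlt, hd⟩

/-- If an event has probability at most `1 / 256`, then it is unlikely that it occurs in a quarter of
`k` independent experiments. -/
theorem uniformProb_quarter_le {Ω : Type} [Finite Ω] [Nonempty Ω] (k : ℕ) (E : Ω → Prop)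
    [DecidablePred E] (hE : uniformProb E ≤ 1 / 256) :
    uniformProb (fun ω : Fin k → Ω => k ≤ 4 * (Finset.univ.filter fun j => E (ω j)).card) ≤
      1 / 2 ^ k := by
  -- Union bound over the at most `2 ^ k` possible sets `T` of failing groups. Each has probability
  -- at most `256 ^ (-|T|) ≤ 4 ^ (-k)`.
  have hmono : ∀ ω : Fin k → Ω, k ≤ 4 * (Finset.univ.filter fun j => E (ω j)).card →
      ∃ T ∈ (Finset.univ : Finset (Finset (Fin k))).filter fun T => k ≤ 4 * T.card,
        ∀ j ∈ T, E (ω j) := fun ω h =>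
    ⟨Finset.univ.filter fun j => E (ω j), by simpa using h, fun j hj => by simpa using hj⟩
  refine (uniformProb_mono hmono).trans ((uniformProb_exists_le _ _).trans ?_)
  have hT : ∀ T ∈ (Finset.univ : Finset (Finset (Fin k))).filter fun T => k ≤ 4 * T.card,
      uniformProb (fun ω : Fin k → Ω => ∀ j ∈ T, E (ω j)) ≤ (1 / 4) ^ k := by
    intro T hT
    rw [Finset.mem_filter] at hT
    rw [uniformProb_pi]
    calc uniformProb E ^ T.card ≤ (1 / 256) ^ T.card :=
          pow_le_pow_left₀ (uniformProb_nonneg _) hE _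
      _ = (1 / 4) ^ (4 * T.card) := by rw [pow_mul]; norm_num
      _ ≤ (1 / 4) ^ k := pow_le_pow_of_le_one (by norm_num) (by norm_num) hT.2
  refine (Finset.sum_le_sum hT).trans ?_
  rw [Finset.sum_const, nsmul_eq_mul]
  calc _ ≤ (2 : ℝ) ^ k * (1 / 4) ^ k := by
        gcongr
        have := Finset.card_filter_le (Finset.univ : Finset (Finset (Fin k)))
          fun T => k ≤ 4 * T.card
        rw [Finset.card_univ, Fintype.card_finset, Fintype.card_fin] at this
        exact_mod_cast this
    _ = 1 / 2 ^ k := by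
        rw [← mul_pow, ← one_div_pow]
        norm_num

end Groups

/-! ## Correctness with high probability -/

section Main

variable {w u : ℕ}

/-- The coins, arranged by groups and fields. -/
def coinGroups (w k : ℕ) :
    (Fin (k * 256 * 6) → BitVec w) ≃ (Fin k → Fin 256 → Fin 6 → BitVec w) :=
  ((Equiv.arrowCongr finProdFinEquiv.symm (Equiv.refl _)).trans (Equiv.curry _ _ _)).trans
    ((Equiv.arrowCongr finProdFinEquiv.symm (Equiv.refl _)).trans (Equiv.curry _ _ _))

theorem fieldCoins_eq_coinGroups {k : ℕ} (ω : Fin (k * 256 * 6) → BitVec w) (j : Fin k)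
    (s : Fin 256) : fieldCoins ω (256 * j + s) = coinGroups w k ω j s := by
  have h : 256 * (j : ℕ) + s < k * 256 := by omega
  funext i
  rw [fieldCoins, dif_pos h]
  change ω _ = ω _
  exact congrArg ω (congrArg finProdFinEquiv (Prod.ext (Fin.ext (Nat.add_comm _ _)) rfl))

theorem getLsbD_getField_sketchBits {L F : ℕ} (hL : 0 < L) (hw : L ≤ w)
    (ω : Fin (F * 6) → BitVec w) {t : ℕ} (ht : t < F) {h : History (Fin u)} (hf : h.Fresh)
    (b : ℕ) : (getField w L t (sketchBits L ω h)).getLsbD b = true ↔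
      Odd ((symmDiff (h.set 0) (h.set 1)).filter fun x : Fin u =>
        (cell L (fieldCoins ω t) (BitVec.ofNat w (x : ℕ))).getLsbD b = true).card := by
  rw [getField_sketchBits hL hw ω ht, History.getLsbD_xorSum _ _ _ hf, decide_eq_true_iff]

/-- In a good group, the lowest one is at a position that corresponds to the size of the difference. -/
theorem GoodGroup.exists_lowBit {L k : ℕ} (hL : 0 < L) (hw : L ≤ w) (hw4 : 4 ≤ w)
    (ω : Fin (k * 256 * 6) → BitVec w) {h : History (Fin u)} (hf : h.Fresh)
    (hd : Nat.clog 2 h.diff ≤ L + 1) {j : Fin k}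
    (hg : GoodGroup L (symmDiff (h.set 0) (h.set 1)) (coinGroups w k ω j)) :
    ∃ m, L - (Nat.clog 2 h.diff + 13) ≤ m ∧ m ≤ L - 1 - (Nat.clog 2 h.diff - 2) ∧
      (lowBit (groupUpTo (fun t => getField w L t (sketchBits L ω h)) j 256)).toNat = 2 ^ m := by
  set D := symmDiff (h.set 0) (h.set 1) with hD
  have hcard : h.diff = D.card := rfl
  rw [hcard] at hd ⊢
  set Y := groupUpTo (fun t => getField w L t (sketchBits L ω h)) j 256 with hY
  have hbit : ∀ i < L, Y.getLsbD (L - 1 - i) = true ↔ ∃ s : Fin 256,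
      Odd (D.filter fun x : Fin u =>
        Hit (coinGroups w k ω j s) (BitVec.ofNat w (x : ℕ)) i).card := by
    intro i hi
    rw [hY, getLsbD_groupUpTo]
    have hs : ∀ s : Fin 256,
        (getField w L (256 * j + s) (sketchBits L ω h)).getLsbD (L - 1 - i) = true ↔
        Odd (D.filter fun x : Fin u =>
          Hit (coinGroups w k ω j s) (BitVec.ofNat w (x : ℕ)) i).card := by
      intro s
      rw [getLsbD_getField_sketchBits hL hw ω (by omega) hf]
      simp only [getLsbD_cell hw4 hw hi, fieldCoins_eq_coinGroups]
      rfl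
    constructor
    · rintro ⟨s, hs', hb⟩
      exact ⟨⟨s, hs'⟩, (hs ⟨s, hs'⟩).1 hb⟩
    · rintro ⟨s, hb⟩
      exact ⟨s, s.2, (hs s).2 hb⟩
  obtain ⟨hg1, hg2⟩ := hg
  -- The level is below `L` by `hd`, so it has a bit in the field.
  have hone := (hbit (Nat.clog 2 D.card - 2) (by omega)).2 hg1
  have hne : Y ≠ 0 := by
    intro h0
    rw [h0] at hone
    simp at hone
  obtain ⟨m, -, hm1, hm2⟩ := exists_lowest_bit hne
  have hmle : m ≤ L - 1 - (Nat.clog 2 D.card - 2) := by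
    by_contra hlt
    rw [hm2 _ (by omega)] at hone
    simp at hone
  refine ⟨m, ?_, hmle, toNat_lowBit hm1 hm2⟩
  by_contra hlt
  have hm3 : m = L - 1 - (L - 1 - m) := by omega
  rw [hm3] at hm1
  obtain ⟨s, ho⟩ := (hbit (L - 1 - m) (by omega)).1 hm1
  obtain ⟨x, hx⟩ := Finset.card_pos.1 ho.pos
  rw [Finset.mem_filter] at hx
  exact hg2 (by omega) s x hx.1 (hx.2.deep (by omega))

/-- With `c = ⌈log₂ d⌉`, the exponent `L - 1 - r` of the estimate lies between `c - 2` and `c + 12 +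
47`: the window ends at level `c + 12`, and rounding adds at most 47. Together with `2 ^ c ≤ 2 * d`
this gives the factor `2 ^ 60`. -/
theorem estimate_of_goodGroups {L k : ℕ} (hL : 0 < L) (hw : L ≤ w) (hw4 : 4 ≤ w)
    (ω : Fin (k * 256 * 6) → BitVec w) {h : History (Fin u)} (hf : h.Fresh)
    (hd0 : 0 < h.diff) (hd : Nat.clog 2 h.diff ≤ L + 1)
    [DecidablePred (GoodGroup (w := w) L (symmDiff (h.set 0) (h.set 1)))]
    (hg : 4 * (Finset.univ.filter fun j : Fin k =>
      ¬ GoodGroup L (symmDiff (h.set 0) (h.set 1)) (coinGroups w k ω j)).card < k) :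
    WithinFactor (2 ^ 60) (estimate (w := w) L k (sketchBits L ω h)).toNat h.diff := by
  classical
  let P : Fin k → Prop := fun j =>
    GoodGroup L (symmDiff (h.set 0) (h.set 1)) (coinGroups w k ω j)
  let Good : ℕ → Prop := fun j => ∃ hj : j < k, P ⟨j, hj⟩
  have hcount : ((Finset.range k).filter Good).card = (Finset.univ.filter P).card := by
    symm
    refine Finset.card_bij (fun j _ => (j : ℕ)) (fun j hj => ?_) (fun i _ j _ h => Fin.ext h)
      fun j hj => ?_
    · simp only [Finset.mem_filter, Finset.mem_univ, true_and, Finset.mem_range] at hj ⊢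
      exact ⟨j.2, j.2, hj⟩
    · simp only [Finset.mem_filter, Finset.mem_univ, true_and, Finset.mem_range] at hj ⊢
      obtain ⟨-, hj, hP⟩ := hj
      exact ⟨⟨j, hj⟩, hP, rfl⟩
  have hsum := Finset.card_filter_add_card_filter_not (s := (Finset.univ : Finset (Fin k))) P
  rw [Finset.card_univ, Fintype.card_fin] at hsum
  have hbad : (Finset.univ.filter fun j : Fin k => ¬ P j).card =
      (Finset.univ.filter fun j : Fin k =>
        ¬ GoodGroup L (symmDiff (h.set 0) (h.set 1)) (coinGroups w k ω j)).card := by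
    congr
  obtain ⟨r, m, h1, h2, h3, h4, h5⟩ := winner_spec (w := w) (by omega)
    (g := fun t => getField w L t (sketchBits L ω h)) (k := k)
    (lo := L - (Nat.clog 2 h.diff + 13)) (hi := L - 1 - (Nat.clog 2 h.diff - 2)) (Good := Good)
    (by omega) (fun j _ hj => by
      obtain ⟨hj, hP⟩ := hj
      have := GoodGroup.exists_lowBit hL hw hw4 ω hf hd (j := ⟨j, hj⟩) hP
      simpa only using this) (by omega)
  have hest : (estimate (w := w) L k (sketchBits L ω h)).toNat = 2 ^ (L - 1 - r) := by
    rw [estimate, BitVec.toNat_udiv, toNat_one_shiftLeft (by omega), h1,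
      Nat.pow_div (by omega) (by norm_num)]
  have hd1 := two_pow_clog_le hd0
  have hd2 : h.diff ≤ 2 ^ Nat.clog 2 h.diff := Nat.le_pow_clog (by norm_num) _
  have e1 : 2 ^ Nat.clog 2 h.diff ≤ 2 ^ (L - 1 - r + 2) :=
    Nat.pow_le_pow_right (by norm_num) (by omega)
  have e2 : 2 ^ (L - 1 - r) ≤ 2 ^ (Nat.clog 2 h.diff + 59) :=
    Nat.pow_le_pow_right (by norm_num) (by omega)
  rw [pow_add] at e1 e2
  have f1 : h.diff ≤ 2 ^ 60 * 2 ^ (L - 1 - r) := by omega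
  have f2 : 2 ^ (L - 1 - r) ≤ 2 ^ 60 * h.diff := by omega
  rw [WithinFactor, hest]
  exact ⟨by exact_mod_cast f1, by exact_mod_cast f2⟩

theorem estimate_of_diff_eq_zero {L k : ℕ} (hL : 0 < L) (hw : L ≤ w)
    (ω : Fin (k * 256 * 6) → BitVec w) {h : History (Fin u)} (hf : h.Fresh) (hd : h.diff = 0) :
    estimate (w := w) L k (sketchBits L ω h) = 0 := by
  have hD : symmDiff (h.set 0) (h.set 1) = ∅ := Finset.card_eq_zero.1 hd
  rw [estimate, winner_zero]
  · exact BitVec.udiv_zero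
  intro t ht
  refine BitVec.eq_of_getLsbD_eq fun i _ => ?_
  have := getLsbD_getField_sketchBits hL hw ω ht hf i
  rw [hD] at this
  simpa using this

theorem le_uniformProb_withinFactor {L k : ℕ} (hL : 0 < L) (hw : L ≤ w) (hw4 : 4 ≤ w)
    (hu : u ≤ 2 ^ w) {h : History (Fin u)} (hf : h.Fresh) (hd : Nat.clog 2 h.diff ≤ L + 1) :
    1 - 1 / 2 ^ k ≤ uniformProb fun ω : Fin (k * 256 * 6) → BitVec w =>
      WithinFactor (2 ^ 60) (estimate (w := w) L k (sketchBits L ω h)).toNat h.diff := by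
  classical
  rcases Nat.eq_zero_or_pos h.diff with hd0 | hd0
  · rw [uniformProb_congr (F := fun _ => True) fun ω => by
      simp [estimate_of_diff_eq_zero hL hw ω hf hd0, hd0, WithinFactor], uniformProb_true]
    have : (0 : ℝ) ≤ 1 / 2 ^ k := by positivity
    linarith
  · let B : (Fin 256 → Fin 6 → BitVec w) → Prop := fun ψ =>
      ¬ GoodGroup L (symmDiff (h.set 0) (h.set 1)) ψ
    have hB := uniformProb_quarter_le k B (uniformProb_not_goodGroup_le hw4 hu hw hd0
      (show Nat.clog 2 h.diff - 2 < w by omega))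
    have hB' := uniformProb_equiv (coinGroups w k) fun ψ : Fin k → Fin 256 → Fin 6 → BitVec w =>
      k ≤ 4 * (Finset.univ.filter fun j => B (ψ j)).card
    have hn := uniformProb_not fun ω : Fin (k * 256 * 6) → BitVec w =>
      k ≤ 4 * (Finset.univ.filter fun j => B (coinGroups w k ω j)).card
    rw [hB'] at hn
    refine le_trans (by rw [hn]; linarith) (uniformProb_mono fun ω hω => ?_)
    exact estimate_of_goodGroups hL hw hw4 ω hf hd0 hd (not_le.1 hω)

theorem History.diff_le {U : Type} [DecidableEq U] (h : History U) :
    h.diff ≤ (h.set 0).card + (h.set 1).card := by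
  refine (Finset.card_le_card fun x hx => ?_).trans (Finset.card_union_le _ _)
  rw [Finset.mem_symmDiff] at hx
  rw [Finset.mem_union]
  tauto

end Main

theorem mainTheorem12 :
    ∃ (update merge query : Cmd) (C K : ℝ),
      ∀ (w u n : ℕ) (δ : ℝ), u ≤ 2 ^ w → 2 ≤ n → n ≤ 2 ^ w → 0 < δ → δ ≤ 1 / 2 →
        ∃ (B R : ℕ) (sketch : (Fin R → BitVec w) → History (Fin u) → BitVec B)
          (answer : (Fin R → BitVec w) → History (Fin u) → BitVec w),
          (B : ℝ) ≤ C * Real.logb 2 (1 / δ) * Real.logb 2 n ∧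
          (R : ℝ) ≤ C * Real.logb 2 (1 / δ) ∧
          (∀ ω, sketch ω .empty = 0) ∧
          UpdateCorrect update (Nat.clog 2 n) ⌈Real.logb 2 (1 / δ)⌉₊
            (C * Real.logb 2 (1 / δ)) sketch ∧
          MergeCorrect merge (Nat.clog 2 n) ⌈Real.logb 2 (1 / δ)⌉₊
            (C * Real.logb 2 (1 / δ)) sketch ∧
          QueryCorrect query (Nat.clog 2 n) ⌈Real.logb 2 (1 / δ)⌉₊
            (C * Real.logb 2 (1 / δ)) sketch answer ∧
          ∀ h : History (Fin u), h.Fresh → (h.set 0).card ≤ n → (h.set 1).card ≤ n →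
            1 - δ ≤ uniformProb fun ω : Fin R → BitVec w =>
              WithinFactor K (answer ω h).toNat h.diff := by
  -- The largest demand on `C` is the bound `46 * 256 * k + 20` for `update` and `merge`; as `k ≤ 2
  -- * l` and `l ≥ 1`, it is at most `23572 * l`.
  refine ⟨updateProgram, mergeProgram, queryProgram, 24000, 2 ^ 60, ?_⟩
  intro w u n δ hu hn hnw hδ hδ2
  set l := Real.logb 2 (1 / δ) with hl
  set k := ⌈l⌉₊ with hk
  have hl1 : 1 ≤ l := by
    rw [hl, Real.le_logb_iff_rpow_le (by norm_num) (by positivity), Real.rpow_one,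
      le_div_iff₀ hδ]
    linarith
  have hkl : (k : ℝ) ≤ 2 * l := by
    have := Nat.ceil_lt_add_one (show 0 ≤ l by linarith)
    linarith
  have hk1 : 0 < k := Nat.ceil_pos.2 (by linarith)
  have hδk : 1 / 2 ^ k ≤ δ := by
    have h1 : 1 / δ ≤ 2 ^ k := by
      have := (Real.logb_le_iff_le_rpow (b := 2) (by norm_num)
        (show 0 < 1 / δ by positivity)).1 (Nat.le_ceil l)
      rwa [Real.rpow_natCast] at this
    exact (one_div_le hδ (by positivity)).1 h1
  have hlog1 : 1 ≤ Real.logb 2 n := by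
    rw [Real.le_logb_iff_rpow_le (by norm_num) (by positivity), Real.rpow_one]
    exact_mod_cast hn
  have hw0 : 0 < w := by
    by_contra h0
    obtain rfl : w = 0 := by omega
    omega
  have hR : ((k * 256 * 6 : ℕ) : ℝ) ≤ 24000 * l := by
    push_cast
    linarith
  by_cases hw4 : 4 ≤ w
  · set L := Nat.clog 2 n with hLdef
    have hL : 0 < L := Nat.clog_pos (by norm_num) hn
    have hLw : L ≤ w := Nat.clog_le_of_le_pow hnw
    have hLlog : (L : ℝ) ≤ 2 * Real.logb 2 n := by
      have h1 : 2 ^ (L - 1) ≤ n := (Nat.pow_pred_clog_lt_self (by norm_num) hn).le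
      have h2 : ((L - 1 : ℕ) : ℝ) ≤ Real.logb 2 n := by
        rw [Real.le_logb_iff_rpow_le (by norm_num) (by positivity), Real.rpow_natCast]
        exact_mod_cast h1
      rw [Nat.cast_sub hL] at h2
      push_cast at h2
      linarith
    refine ⟨layoutBits w L (k * 256), k * 256 * 6, sketchBits L,
      fun ω h => estimate L k (sketchBits L ω h), ?_, hR, fun _ => rfl,
      updateProgram_correct hLw hL ?_, mergeProgram_correct hLw hL ?_,
      queryProgram_correct hLw hL ?_, fun h hf h0 h1 => ?_⟩
    · have h1 : ((layoutBits w L (k * 256) : ℕ) : ℝ) ≤ 3 * (L * (k * 256)) := by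
        exact_mod_cast layoutBits_le hL hLw
      have h2 : (L : ℝ) * k ≤ (2 * Real.logb 2 n) * (2 * l) :=
        mul_le_mul hLlog hkl (by positivity) (by positivity)
      have h3 : 0 ≤ l * Real.logb 2 n := by positivity
      nlinarith
    · push_cast
      linarith
    · push_cast
      linarith
    · push_cast
      linarith
    -- The difference has at most `2 * n ≤ 2 ^ (L + 1)` elements, so level `⌈log₂ d⌉ - 2` is below
    -- `L`.
    · refine le_trans (by linarith) (le_uniformProb_withinFactor hL hLw hw4 hu hf ?_)
      apply Nat.clog_le_of_le_pow
      have h2 : n ≤ 2 ^ L := Nat.le_pow_clog (by norm_num) n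
      have h3 := h.diff_le
      rw [pow_succ]
      omega
  · -- Words of less than four bits cannot address any coins, so only the answer matters.
    have hfit : ¬ k * 256 * 6 ≤ 2 ^ w := by
      have : 2 ^ w ≤ 2 ^ 4 := Nat.pow_le_pow_right (by norm_num) (by omega)
      omega
    have hno : ∀ (μ : BitVec w → BitVec w) (c : ℕ) (ω : Fin (k * 256 * 6) → BitVec w),
        ¬ Holds μ c ω := fun μ c ω hc => hfit (le_trans (Nat.le_add_left _ _) hc.1)
    -- The difference may have `2 ^ w` elements, one more than the largest word; capping it costs
    -- only a constant factor.
    refine ⟨0, k * 256 * 6, fun _ _ => 0, fun _ h => BitVec.ofNat w (min h.diff (2 ^ w - 1)),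
      by rw [Nat.cast_zero]; positivity, hR, fun _ => rfl,
      fun ω _ _ _ _ _ _ hc => absurd hc (hno _ _ _),
      fun ω _ _ _ _ _ _ _ hc => absurd hc (hno _ _ _),
      fun ω _ _ _ _ hc => absurd hc (hno _ _ _), fun h _ _ _ => ?_⟩
    rw [uniformProb_congr (F := fun _ => True), uniformProb_true]
    · linarith
    · intro _
      have h2 : 2 ^ 1 ≤ 2 ^ w := Nat.pow_le_pow_right (by norm_num) hw0
      have h3 : h.diff ≤ 2 ^ w := by
        refine le_trans ?_ hu
        have := Finset.card_le_univ (symmDiff (h.set 0) (h.set 1))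
        rwa [Fintype.card_fin] at this
      rw [WithinFactor, BitVec.toNat_ofNat, Nat.mod_eq_of_lt (by omega), iff_true]
      have f1 : h.diff ≤ 2 ^ 60 * min h.diff (2 ^ w - 1) := by omega
      have f2 : min h.diff (2 ^ w - 1) ≤ 2 ^ 60 * h.diff := by omega
      exact ⟨by exact_mod_cast f1, by exact_mod_cast f2⟩
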